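/- Fix an integer $r\ge 1$. **Invariants.** Let $Q_n(\mathbf X\mid a)=\sum_{j=0}^n\binom nj a_jX^jY^{n-j}$ be the binary $n$-form with coefficient vector $a=(a_0,\dots,a_n)$, and for $M\in \mathrm{GL}_2(\mathbb C)$ let $R_M$ be defined by $Q_n(M\mathbf X\mid R_Ma)=Q_n(\mathbf X\mid a)$. Let $\mathcal B_n^m$ be the space of homogeneous $I\in\mathbb C[a_0,\dots,a_n]$ of degree $m$ for which there is $w\in\mathbb N$ with $I(a)=(\det M)^wI(R_Ma)$ for all $M\in\mathrm{GL}_2(\mathbb C)$. Let $\mathcal B_n^E=\bigoplus_{k\ge0}\mathcal B_n^{2k}$, a graded algebra in which $\mathcal B_n^{2k}$ has degree $k$. Let $\Lambda_3$ be the algebra of symmetric polynomials in $X,Y,Z$ over $\mathbb C$ with its usual grading. **Uniform states.** Let $\mathcal U_N^n$ be the space of symmetric polynomials $P\in\mathbb C[z_1,\dots,z_N]$ of degree at most $n$ in each variable such that $\sum_i\partial_iP=0$, $\sum_i(-\tfrac n2+z_i\partial_i)P=0$ and $\sum_i(nz_i-z_i^2\partial_i)P=0$. Let $\mathscr U$ be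 the linear map with $\mathscr U[z_1^{p_1}\cdots z_N^{p_N}]=a_{p_1}\cdots a_{p_N}$, and $\mathscr S[f]=\sum_{\sigma\in S_N}f(z_{\sigma(1)},\dots,z_{\sigma(N)})$. **Graphs.** A graph $G$ on the nodes $1,\dots,m$ (write $|G|=m$) is given by multiplicities $\mu(i,j)\in\mathbb Z_{\ge0}$ of the arrows $i\to j$ with $\mu(i,j)\mu(j,i)=0$ for all $i,j$; it is $n$-regular if $\sum_i(\mu(i,j)+\mu(j,i))=n$ for all $j$. Put $\mathscr M[G]=\prod_{i,j}(z_i-z_j)^{\mu(i,j)}$. Let $u(G)$ be the greatest common divisor of the coefficients of $\mathscr U[\mathscr M[G]]$ (with $1/u(G)=0$ if this polynomial vanishes), $\Upsilon[G]=\frac1{u(G)}\mathscr U[\mathscr M[G]]$ and $\Psi[G]=\frac1{u(G)}\mathscr S[\mathscr M[G]]$. A proper tricoloring of $G$ is a map $\eta$ from the nodes to the ordered set of colors $\infty>1>0$ that takes different values on adjacent nodes; $v_c(\eta)$ is the number of nodes of color $c$, and $\mathrm{sgn}(\eta)=\prod_{i,j}\mathrm{sgn}(\eta(i)-\eta(j))^{\mu(i,j)}$.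 Put $$K[G]=\frac1{u(G)}\sum_{\eta}\mathrm{sgn}(\eta)\,X^{|G|/2-v_\infty(\eta)}\,Y^{|G|/2-v_1(\eta)}\,Z^{|G|/2-v_0(\eta)},$$ the sum running over all proper tricolorings $\eta$ of $G$. **Theorem.** 1. For all $k\ge0$, $P\in\mathcal U_{2k}^{2r}$ and $a,b,c\ge0$ with $a+b+c=k$, the limit $$P_{a,b,c}=\lim_{w\to\infty}w^{-2r(k-a)}P(w^{\times(k-a)},1^{\times(k-b)},0^{\times(k-c)})$$ (with $w\in\mathbb C$, $|w|\to\infty$) exists. Put $$K[P]=\sum_{a+b+c=k}\frac{P_{a,b,c}}{(k-a)!\,(k-b)!\,(k-c)!}X^aY^bZ^c.$$ 2. For every $k\ge0$, $\mathcal Q(P)=\frac1{(2k)!}\mathscr U[P]$ defines a linear isomorphism $\mathcal Q:\mathcal U_{2k}^{2r}\to\mathcal B_{2r}^{2k}$. There is a homomorphism of $\mathbb C$-algebras $K:\mathcal B_{2r}^E\to\Lambda_3$ such that $K(\mathcal Q(P))=K[P]$ for all $k\ge 0$ and $P\in\mathcal U_{2k}^{2r}$, and it is degree-preserving: it maps $\mathcal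 B_{2r}^{2k}$ to symmetric polynomials that are homogeneous of degree $k$. 3. If $G$ is $2r$-regular with $|G|=2k$, then $\Psi[G]\in\mathcal U_{2k}^{2r}$, $\mathcal Q(\Psi[G])=\Upsilon[G]$ and $K(\Upsilon[G])=K[G]$. 4. Let $G$ be $2r$-regular. Every proper tricoloring $\eta$ of $G$ satisfies $v_c(\eta)\le|G|/2$ for each color $c$. If $|G|$ is odd, then $K[G]=\sqrt{XYZ}\;q$ for a polynomial $q\in\mathbb C[X,Y,Z]$ such that permuting the variables of $q$ by $\sigma\in S_3$ multiplies $q$ by $\mathrm{sgn}(\sigma)^r$ (so $q$ is symmetric if $r$ is even and alternating if $r$ is odd). 5. If $G_1,G_2$ are $2r$-regular (with any numbers of nodes), then so is the disjoint union $G_1\sqcup G_2$, and $\Upsilon[G_1\sqcup G_2]=\Upsilon[G_1]\Upsilon[G_2]$ and $K[G_1\sqcup G_2]=K[G_1]\,K[G_2]$. -/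

import Mathlib

namespace Tricoloring

open MvPolynomial

noncomputable section

/-! ## Binary forms and their invariants -/

/-- The binary `n`-form `∑ⱼ (n choose j) aⱼ Xʲ Yⁿ⁻ʲ` with coefficient vector `a`,
evaluated at `(X, Y) = (v 0, v 1)`. -/
def binaryForm (n : ℕ) (a : Fin (n + 1) → ℂ) (v : Fin 2 → ℂ) : ℂ :=
  ∑ j : Fin (n + 1), (n.choose j : ℂ) * a j * v 0 ^ (j : ℕ) * v 1 ^ (n - (j : ℕ))

/-- `a' = R_M a` for the induced representation `R` of `GL₂(ℂ)` on coefficient vectors, which is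
given by the implicit equality `Q(M X | R_M a) = Q(X | a)`. (Such an `a'` exists and is unique.) -/
def IsInducedAction (n : ℕ) (M : GL (Fin 2) ℂ) (a a' : Fin (n + 1) → ℂ) : Prop :=
  ∀ v : Fin 2 → ℂ,
    binaryForm n a' ((M : Matrix (Fin 2) (Fin 2) ℂ).mulVec v) = binaryForm n a v

/-- `I(a) = (det M)^w I(R_M a)` for all `M ∈ GL₂(ℂ)`: `I` is an invariant of weight `w` of the
binary `n`-ic. -/
def IsInvariant (n w : ℕ) (I : MvPolynomial (Fin (n + 1)) ℂ) : Prop :=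
  ∀ (M : GL (Fin 2) ℂ) (a a' : Fin (n + 1) → ℂ), IsInducedAction n M a a' →
    eval a I = (M : Matrix (Fin 2) (Fin 2) ℂ).det ^ w * eval a' I

theorem weight_eq {n m w : ℕ} {I : MvPolynomial (Fin (n + 1)) ℂ} (hI : I ≠ 0)
    (hm : I.IsHomogeneous m) (hw : IsInvariant n w I) : 2 * w = n * m := by
  obtain ⟨a, ha⟩ : ∃ a, eval a I ≠ 0 := by
    by_contra h
    push Not at h
    exact hI (MvPolynomial.funext fun x => by simpa using h x)
  have hdet : ((2 : ℂ) • (1 : Matrix (Fin 2) (Fin 2) ℂ)).det ≠ 0 := by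
    simp
  have h := hw (Matrix.GeneralLinearGroup.mkOfDetNeZero _ hdet) (fun i => (2 : ℂ) ^ n * a i) a (by
    intro v
    have e : ((Matrix.GeneralLinearGroup.mkOfDetNeZero ((2 : ℂ) • (1 : Matrix (Fin 2) (Fin 2) ℂ))
        hdet : GL (Fin 2) ℂ) : Matrix (Fin 2) (Fin 2) ℂ).mulVec v = (2 : ℂ) • v := by
      simp [Matrix.GeneralLinearGroup.mkOfDetNeZero, Matrix.smul_mulVec]
    rw [e]
    unfold binaryForm
    refine Finset.sum_congr rfl fun j _ => ?_
    have hj : (2 : ℂ) ^ n = 2 ^ (j : ℕ) * 2 ^ (n - (j : ℕ)) := by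
      rw [← pow_add, Nat.add_sub_cancel' (Nat.lt_succ_iff.mp j.2)]
    simp only [Pi.smul_apply, smul_eq_mul, mul_pow, hj]
    ring)
  have e2 : eval (fun i => (2 : ℂ) ^ n * a i) I = ((2 : ℂ) ^ n) ^ m * eval a I := by
    rw [eval_eq, eval_eq, Finset.mul_sum]
    refine Finset.sum_congr rfl fun d hd => ?_
    have hd' : ∑ i ∈ d.support, d i = m := by
      rw [← Finsupp.degree_apply, Finsupp.degree_eq_weight_one]
      exact hm (mem_support_iff.mp hd)
    simp only [mul_pow, Finset.prod_mul_distrib]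
    rw [Finset.prod_pow_eq_pow_sum, hd']
    ring
  rw [e2] at h
  have h3 := mul_right_cancel₀ ha h
  have h4 : (2 : ℂ) ^ (n * m) = (2 : ℂ) ^ (2 * w) := by
    rw [pow_mul, h3, pow_mul]
    simp [Matrix.GeneralLinearGroup.mkOfDetNeZero]
  have h5 : (2 : ℕ) ^ (n * m) = 2 ^ (2 * w) := by exact_mod_cast h4
  exact (Nat.pow_right_injective le_rfl h5).symm

/-- `𝓑ₙᵐ`: the space of invariants of degree `m` of the binary `n`-ic. -/
def invariants (n m : ℕ) : Submodule ℂ (MvPolynomial (Fin (n + 1)) ℂ) where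
  carrier := {I | I.IsHomogeneous m ∧ ∃ w : ℕ, IsInvariant n w I}
  zero_mem' := ⟨isHomogeneous_zero _ _ _, 0, fun M a a' _ => by simp⟩
  add_mem' := by
    rintro I J ⟨hI, w, hw⟩ ⟨hJ, w', hw'⟩
    refine ⟨hI.add hJ, ?_⟩
    by_cases h0 : I = 0
    · exact ⟨w', by simpa [h0] using hw'⟩
    by_cases h1 : J = 0
    · exact ⟨w, by simpa [h1] using hw⟩
    have : w = w' := by
      have h2 := weight_eq h0 hI hw
      have h3 := weight_eq h1 hJ hw'
      omega
    subst this
    refine ⟨w, fun M a a' h => ?_⟩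
    rw [map_add, map_add, hw M a a' h, hw' M a a' h, mul_add]
  smul_mem' := by
    rintro c I ⟨hI, w, hw⟩
    refine ⟨(homogeneousSubmodule _ _ m).smul_mem c hI, w, fun M a a' h => ?_⟩
    rw [smul_eval, smul_eval, hw M a a' h]
    ring

theorem one_mem_invariants (n : ℕ) : (1 : MvPolynomial (Fin (n + 1)) ℂ) ∈ invariants n 0 :=
  ⟨isHomogeneous_one _ _, 0, fun M a a' _ => by simp⟩

theorem mul_mem_invariants {n m m' : ℕ} {I J : MvPolynomial (Fin (n + 1)) ℂ}
    (hI : I ∈ invariants n m) (hJ : J ∈ invariants n m') : I * J ∈ invariants n (m + m') := by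
  obtain ⟨hI, w, hw⟩ := hI
  obtain ⟨hJ, w', hw'⟩ := hJ
  refine ⟨hI.mul hJ, w + w', fun M a a' h => ?_⟩
  rw [map_mul, map_mul, hw M a a' h, hw' M a a' h, pow_add]
  ring

/-- The even subalgebra `𝓑ₙᴱ = ⨁ₖ 𝓑ₙ²ᵏ` (an internal direct sum inside `ℂ[a₀, …, aₙ]`, whose
`k`-th graded piece is `𝓑ₙ²ᵏ`). -/
def evenInvariants (n : ℕ) : Subalgebra ℂ (MvPolynomial (Fin (n + 1)) ℂ) :=
  (⨆ k : ℕ, invariants n (2 * k)).toSubalgebra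
    (Submodule.mem_iSup_of_mem 0 (one_mem_invariants n))
    (by
      intro x y hx hy
      induction hx using Submodule.iSup_induction' with
      | zero => simp
      | add x x' _ _ h h' => rw [add_mul]; exact add_mem h h'
      | mem k x hx =>
        induction hy using Submodule.iSup_induction' with
        | zero => simp
        | add y y' _ _ h h' => rw [mul_add]; exact add_mem h h'
        | mem l y hy =>
          refine Submodule.mem_iSup_of_mem (k + l) ?_
          rw [mul_add]
          exact mul_mem_invariants hx hy)

/-- The inclusion of the `k`-th graded piece `𝓑ₙ²ᵏ` into `𝓑ₙᴱ`. -/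
def ofPiece {n k : ℕ} (I : invariants n (2 * k)) : evenInvariants n :=
  ⟨I, Submodule.mem_iSup_of_mem (p := fun k => invariants n (2 * k)) k I.2⟩

/-! ## Uniform states and quantization -/

/-- `𝓤_N^{n}`: the space of `(N, n)` uniform states, i.e. symmetric polynomials in `z₁, …, z_N` of
degree at most `n` in each variable that are annihilated by
`L₋ = ∑ ∂ᵢ`, `L_z = ∑ (-n/2 + zᵢ ∂ᵢ)` and `L₊ = ∑ (n zᵢ - zᵢ² ∂ᵢ)`. -/
def uniformStates (N n : ℕ) : Submodule ℂ (MvPolynomial (Fin N) ℂ) where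
  carrier := {P | P.IsSymmetric ∧ (∀ i, P.degreeOf i ≤ n) ∧
    ∑ i, pderiv i P = 0 ∧
    ∑ i, (C (-(n : ℂ) / 2) * P + X i * pderiv i P) = 0 ∧
    ∑ i, (C (n : ℂ) * X i * P - X i ^ 2 * pderiv i P) = 0}
  zero_mem' := ⟨IsSymmetric.zero, by simp, by simp, by simp, by simp⟩
  add_mem' := by
    rintro P P' ⟨h1, h2, h3, h4, h5⟩ ⟨h1', h2', h3', h4', h5'⟩
    refine ⟨h1.add h1', fun i => (degreeOf_add_le i P P').trans (max_le (h2 i) (h2' i)), ?_, ?_, ?_⟩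
    · simp only [map_add, Finset.sum_add_distrib, h3, h3', add_zero]
    · calc _ = ∑ i, ((C (-(n : ℂ) / 2) * P + X i * pderiv i P) +
            (C (-(n : ℂ) / 2) * P' + X i * pderiv i P')) :=
            Finset.sum_congr rfl fun i _ => by rw [map_add]; ring
        _ = 0 := by rw [Finset.sum_add_distrib, h4, h4', add_zero]
    · calc _ = ∑ i, ((C (n : ℂ) * X i * P - X i ^ 2 * pderiv i P) +
            (C (n : ℂ) * X i * P' - X i ^ 2 * pderiv i P')) :=
            Finset.sum_congr rfl fun i _ => by rw [map_add]; ring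
        _ = 0 := by rw [Finset.sum_add_distrib, h5, h5', add_zero]
  smul_mem' := by
    rintro c P ⟨h1, h2, h3, h4, h5⟩
    refine ⟨h1.smul c, fun i => (degreeOf_le_iff.mpr fun d hd =>
      degreeOf_le_iff.mp (h2 i) d (support_smul hd)), ?_, ?_, ?_⟩
    · simp only [Derivation.map_smul, ← Finset.smul_sum, h3, smul_zero]
    · simp only [Derivation.map_smul, mul_smul_comm, ← smul_add, ← Finset.smul_sum, h4, smul_zero]
    · simp only [Derivation.map_smul, mul_smul_comm, ← smul_sub, ← Finset.smul_sum, h5, smul_zero]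

/-- The umbral evaluation `z₁^{p₁} ⋯ z_N^{p_N} ↦ a_{p₁} ⋯ a_{p_N}`, extended linearly. -/
def umbral (R : Type) [CommRing R] (N : ℕ) : MvPolynomial (Fin N) R →ₗ[R] MvPolynomial ℕ R :=
  (basisMonomials (Fin N) R).constr R fun p => ∏ i, X (p i)

/-- The inclusion `ℂ[a₀, …, aₙ] ⊆ ℂ[a₀, a₁, a₂, …]`. -/
def inclCoeff (n : ℕ) : MvPolynomial (Fin (n + 1)) ℂ →ₐ[ℂ] MvPolynomial ℕ ℂ :=
  rename fun j => (j : ℕ)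

/-- The symmetrization `𝓢[f] = ∑_σ f(z_{σ 1}, …, z_{σ N})` (without the factor `1 / N!`). -/
def symmetrize (N : ℕ) (f : MvPolynomial (Fin N) ℂ) : MvPolynomial (Fin N) ℂ :=
  ∑ σ : Equiv.Perm (Fin N), rename σ f

/-! ## Three-point specializations and their generating function -/

/-- The point `(w^{×(k-a)}, 1^{×(k-b)}, 0^{×(k-c)})`, where `a + b + c = k`. -/
def threePoint (k a b : ℕ) (w : ℂ) (i : Fin (2 * k)) : ℂ :=
  if (i : ℕ) < k - a then w else if (i : ℕ) < (k - a) + (k - b) then 1 else 0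

/-- `w^{-2r(k-a)} P(w^{×(k-a)}, 1^{×(k-b)}, 0^{×(k-c)})`, where `a + b + c = k`. -/
def specFun (r k : ℕ) (P : MvPolynomial (Fin (2 * k)) ℂ) (a b : ℕ) (w : ℂ) : ℂ :=
  (w ^ (2 * r * (k - a)))⁻¹ * eval (threePoint k a b w) P

/-- The specialization `P_{a,b,c}` with `a + b + c = k`: the limit of `specFun` as `w → ∞`. -/
def spec (r k : ℕ) (P : MvPolynomial (Fin (2 * k)) ℂ) (a b : ℕ) : ℂ :=
  Filter.limUnder (Bornology.cobounded ℂ) (specFun r k P a b)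

/-- `K[P] = ∑_{a+b+c=k} P_{a,b,c} / ((k-a)! (k-b)! (k-c)!) Xᵃ Yᵇ Zᶜ`,
with `(a, b, c) = (t 0, t 1, t 2)` and `(X, Y, Z) = (X 0, X 1, X 2)`. -/
def genFun (r k : ℕ) (P : MvPolynomial (Fin (2 * k)) ℂ) : MvPolynomial (Fin 3) ℂ :=
  ∑ t ∈ Finset.Nat.antidiagonalTuple 3 k,
    C (spec r k P (t 0) (t 1) /
        ((k - t 0).factorial * (k - t 1).factorial * (k - t 2).factorial : ℂ)) *
      (X 0 ^ t 0 * X 1 ^ t 1 * X 2 ^ t 2)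

/-! ## Graphs and tricolorings -/

/-- A weighted directed graph on the nodes `1, …, m`; `mult i j` is the multiplicity of the arrow
`i → j`, and all arrows between two nodes point in the same direction. -/
structure WGraph (m : ℕ) where
  mult : Fin m → Fin m → ℕ
  one_way : ∀ i j, mult i j * mult j i = 0

namespace WGraph

variable {m m₁ m₂ : ℕ}

/-- `n`-regularity. -/
def IsRegular (G : WGraph m) (n : ℕ) : Prop :=
  ∀ j, ∑ i, (G.mult i j + G.mult j i) = n

/-- The disjoint union; the nodes of `G₁` come first. -/
def disjUnion (G₁ : WGraph m₁) (G₂ : WGraph m₂) : WGraph (m₁ + m₂) where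
  mult x y := Fin.addCases
    (fun i => Fin.addCases (fun j => G₁.mult i j) (fun _ => 0) y)
    (fun i => Fin.addCases (fun _ => 0) (fun j => G₂.mult i j) y) x
  one_way := by
    intro x y
    refine Fin.addCases (fun i => ?_) (fun i => ?_) x <;>
      refine Fin.addCases (fun j => ?_) (fun j => ?_) y <;>
      simp only [Fin.addCases_left, Fin.addCases_right, G₁.one_way, G₂.one_way, mul_zero]

/-- The graph monomial `∏ (zᵢ - zⱼ)^{μ(i,j)}`. -/
def monomial (R : Type) [CommRing R] (G : WGraph m) : MvPolynomial (Fin m) R :=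
  ∏ i, ∏ j, (X i - X j) ^ G.mult i j

/-- `u(G)`: the greatest common divisor of the (integer) coefficients of the umbral evaluation of
the graph monomial. If this umbral evaluation vanishes, then `u(G) = 0` here; below only `1 / u(G)`
is used, whose value is then `0`, in accordance with the convention `u(G) = ∞`. -/
def u (G : WGraph m) : ℕ :=
  (umbral ℤ m (G.monomial ℤ)).support.gcd fun ν => ((umbral ℤ m (G.monomial ℤ)).coeff ν).natAbs

/-- The umbralized graph polynomial `Υ[G]`. -/
def ups (G : WGraph m) : MvPolynomial ℕ ℂ :=
  (G.u : ℂ)⁻¹ • umbral ℂ m (G.monomial ℂ)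

/-- The symmetrized graph polynomial `Ψ[G]`. -/
def psi (G : WGraph m) : MvPolynomial (Fin m) ℂ :=
  (G.u : ℂ)⁻¹ • symmetrize m (G.monomial ℂ)

/-- Proper tricolorings. The elements `2, 1, 0` of `Fin 3` stand for the ordered colors
`∞ > 1 > 0`. -/
def IsProper (G : WGraph m) (η : Fin m → Fin 3) : Prop :=
  ∀ i j, G.mult i j ≠ 0 → η i ≠ η j

/-- The sign of a tricoloring: the product over all arrows `i → j` of `sgn(η(i) - η(j))`. -/
def colorSign (G : WGraph m) (η : Fin m → Fin 3) : ℤ :=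
  ∏ i, ∏ j, (((η i : ℕ) : ℤ) - ((η j : ℕ) : ℤ)).sign ^ G.mult i j

end WGraph

/-- The number of nodes of color `c`. -/
def colorCount {m : ℕ} (η : Fin m → Fin 3) (c : Fin 3) : ℕ :=
  (Finset.univ.filter fun i => η i = c).card

/-- The ring of finite sums of monomials `c · X^α Y^β Z^γ` with rational exponents. -/
abbrev FracPoly : Type := AddMonoidAlgebra ℂ (Fin 3 → ℚ)

/-- The monomial `X^{e 0} Y^{e 1} Z^{e 2}`. -/
def fracMonomial (e : Fin 3 → ℚ) : FracPoly := AddMonoidAlgebra.single e 1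

/-- The inclusion of `ℂ[X, Y, Z]` into the ring of fractional polynomials. -/
def toFrac : MvPolynomial (Fin 3) ℂ →ₐ[ℂ] FracPoly :=
  aeval fun i => fracMonomial (Pi.single i 1)

open Classical in
/-- `K[G] = (1 / u(G)) ∑_η sgn(η) X^{|G|/2 - v_∞(η)} Y^{|G|/2 - v_1(η)} Z^{|G|/2 - v_0(η)}`, the sum
running over all proper tricolorings `η` of `G`. -/
def WGraph.tricolorSum {m : ℕ} (G : WGraph m) : FracPoly :=
  (G.u : ℂ)⁻¹ • ∑ η : Fin m → Fin 3 with G.IsProper η,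
    (G.colorSign η : ℂ) • fracMonomial
      ![(m : ℚ) / 2 - colorCount η 2, (m : ℚ) / 2 - colorCount η 1, (m : ℚ) / 2 - colorCount η 0]

end

end Tricoloring

/-!
The idea is to replace a polynomial `P` in `z₁, …, z_N`, of degree at most `n` in each variable,
by its multihomogenization, a function `homEval n u P` of `N` points `uᵢ = (xᵢ, yᵢ)` of `ℂ²`, on
which `GL₂(ℂ)` acts diagonally. Two facts connect the two sides of the quantization map.

* `L₋` and `L₊` are the infinitesimal generators of the two unipotent subgroups, and `L_z P = 0`
  says that `P` is homogeneous of degree `nN / 2`. Hence a symmetric `P` is a uniform state if and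
  only if its multihomogenization is multiplied by a power of the determinant
  (`isSemiInv_of_mem_uniformStates`, `mem_uniformStates_of_isSemiInv`).
* Umbral evaluation applies the functional `zʲ ↦ aⱼ` to each variable. If `a = ∑ₛ cₛ ν(uₛ)` for
  points `ν(uₛ)` of the rational normal curve, then
  `𝓤[P](a) = ∑_f (∏ᵢ c_{f(i)}) P(u_{f(1)}, …, u_{f(N)})` (`aeval_umbral`). Every `a` has this form, and the coefficient of `c₁ ⋯ c_N` recovers
  a symmetric `P` from `𝓤[P]`. So semi-invariance of `P` and invariance of `𝓤[P]` are equivalent.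

The tricoloring homomorphism is evaluation at one vector `a` in this expansion, with the three
points `∞, 1, 0` and the coefficients `√(YZ/X), √(XZ/Y), √(XY/Z)` (`triEval`). It is therefore an
algebra homomorphism from the start, with values in the fractional polynomials; the expansion is a
sum over all colorings `f` of the nodes, in which the exponent of the variable of color `c` is
`N / 2 - v_c(f)`. Its values on even invariants are honest symmetric polynomials:

* letting a diagonal matrix degenerate shows that a semi-invariant vanishes where more than half
  of its arguments coincide, so that no exponent is negative (`homEval_colorPoint_eq_zero`);
* the matrices that permute the three points up to sign have determinant the sign of the
  permutation (`homEval_colorPoint_perm`). This gives symmetry for even `N`, and the factor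
  `sgn(σ) ^ r` for odd `N`.

Grouping colorings by their color counts gives `K[P]` (`triPoly_eq_smul_genFun`). For a graph
monomial the multihomogenization is the product of the determinants `xᵢyⱼ - xⱼyᵢ` over the arrows,
which at a coloring is its sign, and vanishes unless the coloring is proper
(`WGraph.homEval_colorPoint`); thus `triEval` maps `Υ[G]` to `K[G]` for every regular graph
(`WGraph.triEval_ups`). Multiplicativity of `K[G]` then follows from that of `Υ[G]`, which rests
on Gauss's lemma (`intContent_mul`).
-/

namespace Tricoloring

open MvPolynomial

noncomputable section

variable {n N r w k m m₁ m₂ : ℕ}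

/-! ### Multihomogeneous evaluation -/

/-- The value at `v = (x, y)` of the degree-`n` homogenization `xʲ yⁿ⁻ʲ` of `zʲ`. -/
def veronese (n : ℕ) (v : Fin 2 → ℂ) (j : ℕ) : ℂ := v 0 ^ j * v 1 ^ (n - j)

/-- The value at `(u₁, …, u_N) ∈ (ℂ²)^N` of the multihomogenization of `P` of degree `n` in each
of the `N` variables: `z₁^{p₁} ⋯ z_N^{p_N}` becomes `∏ᵢ xᵢ^{pᵢ} yᵢ^{n - pᵢ}` at `uᵢ = (xᵢ, yᵢ)`. It
is meaningful for polynomials of degree at most `n` in each variable. -/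
def homEval (n : ℕ) {N : ℕ} (u : Fin N → Fin 2 → ℂ) : MvPolynomial (Fin N) ℂ →ₗ[ℂ] ℂ :=
  (basisMonomials (Fin N) ℂ).constr ℂ fun p => ∏ i, veronese n (u i) (p i)

/-- `P` transforms by `det ^ w` under the diagonal action of `GL₂(ℂ)` on its multihomogenization. -/
def IsSemiInv (n w : ℕ) {N : ℕ} (P : MvPolynomial (Fin N) ℂ) : Prop :=
  ∀ M : Matrix (Fin 2) (Fin 2) ℂ, M.det ≠ 0 → ∀ u : Fin N → Fin 2 → ℂ,
    homEval n (fun i => M.mulVec (u i)) P = M.det ^ w * homEval n u P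

theorem monomial_eq_smul_basisMonomials {R : Type} [CommRing R] (p : Fin N →₀ ℕ) (c : R) :
    monomial p c = c • basisMonomials (Fin N) R p := by
  rw [coe_basisMonomials, smul_monomial, smul_eq_mul, mul_one]

@[simp] theorem homEval_monomial (u : Fin N → Fin 2 → ℂ) (p : Fin N →₀ ℕ) (c : ℂ) :
    homEval n u (monomial p c) = c * ∏ i, veronese n (u i) (p i) := by
  rw [monomial_eq_smul_basisMonomials, map_smul, homEval, Module.Basis.constr_basis, smul_eq_mul]

theorem induction_of_degreeOf_le {P : MvPolynomial (Fin N) ℂ}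
    {motive : MvPolynomial (Fin N) ℂ → Prop} (hP : ∀ i, P.degreeOf i ≤ n)
    (mono : ∀ (p : Fin N →₀ ℕ) (c : ℂ), (∀ i, p i ≤ n) → motive (monomial p c))
    (zero : motive 0) (add : ∀ P P', motive P → motive P' → motive (P + P')) : motive P := by
  rw [P.as_sum]
  exact Finset.sum_induction _ motive add zero
    fun p hp => mono p _ fun i => degreeOf_le_iff.mp (hP i) p hp

theorem veronese_smul (l : ℂ) (v : Fin 2 → ℂ) {j : ℕ} (hj : j ≤ n) :
    veronese n (l • v) j = l ^ n * veronese n v j := by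
  have : l ^ n = l ^ j * l ^ (n - j) := by rw [← pow_add, Nat.add_sub_cancel' hj]
  simp only [veronese, Pi.smul_apply, smul_eq_mul, mul_pow, this]
  ring

theorem homEval_smul {P : MvPolynomial (Fin N) ℂ} (hP : ∀ i, P.degreeOf i ≤ n)
    (l : Fin N → ℂ) (u : Fin N → Fin 2 → ℂ) :
    homEval n (fun i => l i • u i) P = (∏ i, l i ^ n) * homEval n u P := by
  refine induction_of_degreeOf_le (motive := fun P =>
    homEval n (fun i => l i • u i) P = (∏ i, l i ^ n) * homEval n u P) hP
    (fun p c hp => ?_) (by simp) fun P P' h h' => ?_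
  · simp only [homEval_monomial]
    rw [Finset.prod_congr rfl fun i _ => veronese_smul (l i) (u i) (hp i), Finset.prod_mul_distrib]
    ring
  · rw [map_add, map_add, h, h', mul_add]

theorem homEval_affine (P : MvPolynomial (Fin N) ℂ) (x : Fin N → ℂ) :
    homEval n (fun i => ![x i, 1]) P = eval x P := by
  induction P using MvPolynomial.induction_on' with
  | monomial p c => simp [eval_monomial, veronese, Finsupp.prod_fintype]
  | add P P' h h' => rw [map_add, map_add, h, h']

theorem homEval_rename (P : MvPolynomial (Fin N) ℂ) (σ : Equiv.Perm (Fin N))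
    (u : Fin N → Fin 2 → ℂ) : homEval n u (rename σ P) = homEval n (u ∘ σ) P := by
  induction P using MvPolynomial.induction_on' with
  | monomial p c =>
    rw [rename_monomial, homEval_monomial, homEval_monomial]
    congr 1
    refine (Fintype.prod_equiv σ _ _ fun i => ?_).symm
    rw [Finsupp.mapDomain_apply σ.injective, Function.comp]
  | add P P' h h' => rw [map_add, map_add, map_add, h, h']

theorem continuous_homEval (P : MvPolynomial (Fin N) ℂ) :
    Continuous fun u : Fin N → Fin 2 → ℂ => homEval n u P := by
  induction P using MvPolynomial.induction_on' with
  | monomial p c => simp only [homEval_monomial, veronese]; fun_prop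
  | add P P' h h' => simp only [map_add]; exact h.add h'

theorem eq_zero_of_homEval_eq_zero {P : MvPolynomial (Fin N) ℂ} (h : ∀ u, homEval n u P = 0) :
    P = 0 :=
  MvPolynomial.funext fun x => by rw [← homEval_affine (n := n), h, map_zero]

/-! ### Uniform states are the semi-invariant symmetric polynomials -/

/-- The lowering operator `L₋`. -/
def lowerOp (P : MvPolynomial (Fin N) ℂ) : MvPolynomial (Fin N) ℂ := ∑ i, pderiv i P

/-- The raising operator `L₊`. -/
def raiseOp (n : ℕ) (P : MvPolynomial (Fin N) ℂ) : MvPolynomial (Fin N) ℂ :=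
  ∑ i, (C (n : ℂ) * X i * P - X i ^ 2 * pderiv i P)

theorem lowerOp_add (P P' : MvPolynomial (Fin N) ℂ) :
    lowerOp (P + P') = lowerOp P + lowerOp P' := by
  simp only [lowerOp, map_add, Finset.sum_add_distrib]

theorem raiseOp_add (P P' : MvPolynomial (Fin N) ℂ) :
    raiseOp n (P + P') = raiseOp n P + raiseOp n P' := by
  simp only [raiseOp, ← Finset.sum_add_distrib]
  exact Finset.sum_congr rfl fun i _ => by rw [map_add]; ring

theorem raiseOp_monomial (p : Fin N →₀ ℕ) (c : ℂ) :
    raiseOp n (monomial p c) =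
      ∑ i, monomial (p + Finsupp.single i 1) (c * ((n : ℂ) - p i)) := by
  refine Finset.sum_congr rfl fun i _ => ?_
  have h1 : (C (n : ℂ) * X i * monomial p c : MvPolynomial (Fin N) ℂ) =
      monomial (p + Finsupp.single i 1) (n * c) := by
    rw [mul_assoc, X, monomial_mul, C_mul_monomial, one_mul, add_comm]
  have h2 : (X i ^ 2 * pderiv i (monomial p c) : MvPolynomial (Fin N) ℂ) =
      monomial (p + Finsupp.single i 1) (c * p i) := by
    rw [pderiv_monomial]
    rcases Nat.eq_zero_or_pos (p i) with h | h
    · simp [h]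
    · rw [X_pow_eq_monomial, monomial_mul, one_mul]
      congr 2
      ext j
      by_cases hj : j = i
      · subst hj; simp; omega
      · simp [Ne.symm hj]
  rw [h1, h2, ← map_sub]
  congr 1
  ring

/-- The product rule for the multihomogenization of a monomial whose `i`-th factor has as derivative
a multiple of the factor with exponent `q i i`. -/
theorem hasDerivAt_homEval_monomial {u : ℂ → Fin N → Fin 2 → ℂ} {t : ℂ} {p : Fin N →₀ ℕ}
    {c : ℂ} {l : Fin N → ℂ} {q : Fin N → Fin N →₀ ℕ} (hq : ∀ i j, j ≠ i → q i j = p j)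
    (h : ∀ i, HasDerivAt (fun t => veronese n (u t i) (p i))
      (l i * veronese n (u t i) (q i i)) t) :
    HasDerivAt (fun t => homEval n (u t) (monomial p c))
      (homEval n (u t) (∑ i, monomial (q i) (c * l i))) t := by
  simp only [homEval_monomial, map_sum]
  refine ((HasDerivAt.fun_finsetProd (u := Finset.univ) fun i _ => h i).const_mul c).congr_deriv ?_
  rw [Finset.mul_sum]
  refine Finset.sum_congr rfl fun i _ => ?_
  rw [← Finset.mul_prod_erase Finset.univ (fun j => veronese n (u t j) (q i j))
    (Finset.mem_univ i), Finset.prod_congr rfl fun j hj =>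
      congrArg (veronese n (u t j)) (hq i j (Finset.ne_of_mem_erase hj)), smul_eq_mul]
  ring

/-- The upper unipotent subgroup acts with infinitesimal generator `L₋`. -/
theorem hasDerivAt_homEval_lowerOp {P : MvPolynomial (Fin N) ℂ} (hP : ∀ i, P.degreeOf i ≤ n)
    (u : Fin N → Fin 2 → ℂ) (t : ℂ) :
    HasDerivAt (fun t => homEval n (fun i => ![u i 0 + t * u i 1, u i 1]) P)
      (homEval n (fun i => ![u i 0 + t * u i 1, u i 1]) (lowerOp P)) t := by
  refine induction_of_degreeOf_le (motive := fun P => HasDerivAt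
    (fun t => homEval n (fun i => ![u i 0 + t * u i 1, u i 1]) P)
    (homEval n (fun i => ![u i 0 + t * u i 1, u i 1]) (lowerOp P)) t) hP
    (fun p c hp => ?_) ?_ fun P P' h h' => ?_
  · simp only [lowerOp, pderiv_monomial]
    refine hasDerivAt_homEval_monomial (p := p) (q := fun i => p - Finsupp.single i 1)
      (fun i j hj => by simp [hj.symm]) fun i => ?_
    have h1 : HasDerivAt (fun t : ℂ => u i 0 + t * u i 1) (u i 1) t := by
      simpa using ((hasDerivAt_id t).mul_const (u i 1)).const_add (u i 0)
    refine ((h1.pow (p i)).mul_const (u i 1 ^ (n - p i))).congr_deriv ?_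
    have := hp i
    rcases Nat.eq_zero_or_pos (p i) with h0 | h0
    · simp [h0]
    · have e : n - (p i - 1) = n - p i + 1 := by omega
      simp [veronese, e, pow_succ]
      ring
  · simpa [lowerOp] using hasDerivAt_const t (0 : ℂ)
  · simp only [lowerOp_add, map_add]
    exact h.add h'

/-- The lower unipotent subgroup acts with infinitesimal generator `L₊`. -/
theorem hasDerivAt_homEval_raiseOp {P : MvPolynomial (Fin N) ℂ} (hP : ∀ i, P.degreeOf i ≤ n)
    (u : Fin N → Fin 2 → ℂ) (t : ℂ) :
    HasDerivAt (fun t => homEval n (fun i => ![u i 0, u i 1 + t * u i 0]) P)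
      (homEval n (fun i => ![u i 0, u i 1 + t * u i 0]) (raiseOp n P)) t := by
  refine induction_of_degreeOf_le (motive := fun P => HasDerivAt
    (fun t => homEval n (fun i => ![u i 0, u i 1 + t * u i 0]) P)
    (homEval n (fun i => ![u i 0, u i 1 + t * u i 0]) (raiseOp n P)) t) hP
    (fun p c hp => ?_) ?_ fun P P' h h' => ?_
  · rw [raiseOp_monomial]
    refine hasDerivAt_homEval_monomial (p := p) (q := fun i => p + Finsupp.single i 1)
      (fun i j hj => by simp [hj.symm]) fun i => ?_
    have h1 : HasDerivAt (fun t : ℂ => u i 1 + t * u i 0) (u i 0) t := by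
      simpa using ((hasDerivAt_id t).mul_const (u i 0)).const_add (u i 1)
    refine ((h1.pow (n - p i)).const_mul (u i 0 ^ p i)).congr_deriv ?_
    have e : n - (p i + 1) = n - p i - 1 := by omega
    simp [veronese, e, pow_succ, Nat.cast_sub (hp i)]
    ring
  · simpa [raiseOp] using hasDerivAt_const t (0 : ℂ)
  · simp only [raiseOp_add, map_add]
    exact h.add h'

/-- `L_z` acts on the coefficient of `z₁^{p₁} ⋯ z_N^{p_N}` by the scalar `∑ᵢ (pᵢ - n / 2)`. -/
theorem sum_weightOp_eq (P : MvPolynomial (Fin N) ℂ) (p : Fin N →₀ ℕ) :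
    coeff p (∑ i, (C (-(n : ℂ) / 2) * P + X i * pderiv i P)) =
      (-(n : ℂ) / 2 * N + ∑ i, (p i : ℂ)) * coeff p P := by
  have h : ∀ i, coeff p (X i * pderiv i P) = p i * coeff p P := by
    intro i
    induction P using MvPolynomial.induction_on' with
    | monomial q c =>
      rw [pderiv_monomial]
      rcases Nat.eq_zero_or_pos (q i) with h | h
      · by_cases hq : q = p
        · subst hq; simp [h]
        · simp [h, coeff_monomial, hq]
      · rw [X, monomial_mul, one_mul,
          add_tsub_cancel_of_le (Finsupp.single_le_iff.mpr h), coeff_monomial, coeff_monomial]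
        split_ifs with hq
        · subst hq; ring
        · simp
    | add P P' h h' => rw [map_add, mul_add, coeff_add, h, h', coeff_add, mul_add]
  rw [coeff_sum, Finset.sum_congr rfl fun i _ => by rw [coeff_add, coeff_C_mul, h i],
    Finset.sum_add_distrib, Finset.sum_const, Finset.card_univ, Fintype.card_fin, nsmul_eq_mul,
    add_mul, Finset.sum_mul]
  ring

theorem mem_uniformStates_iff {P : MvPolynomial (Fin N) ℂ} :
    P ∈ uniformStates N n ↔ P.IsSymmetric ∧ (∀ i, P.degreeOf i ≤ n) ∧ lowerOp P = 0 ∧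
      ∑ i, (C (-(n : ℂ) / 2) * P + X i * pderiv i P) = 0 ∧ raiseOp n P = 0 := Iff.rfl

theorem homEval_upper {P : MvPolynomial (Fin N) ℂ} (hP : ∀ i, P.degreeOf i ≤ n)
    (h : lowerOp P = 0) (t : ℂ) (u : Fin N → Fin 2 → ℂ) :
    homEval n (fun i => ![u i 0 + t * u i 1, u i 1]) P = homEval n u P := by
  have hd := fun s => hasDerivAt_homEval_lowerOp hP u s
  simp only [h, map_zero] at hd
  have := is_const_of_deriv_eq_zero (fun s => (hd s).differentiableAt) (fun s => (hd s).deriv) t 0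
  simp only [zero_mul, add_zero] at this
  rw [this]
  congr 2
  ext i j
  fin_cases j <;> rfl

theorem homEval_lower {P : MvPolynomial (Fin N) ℂ} (hP : ∀ i, P.degreeOf i ≤ n)
    (h : raiseOp n P = 0) (t : ℂ) (u : Fin N → Fin 2 → ℂ) :
    homEval n (fun i => ![u i 0, u i 1 + t * u i 0]) P = homEval n u P := by
  have hd := fun s => hasDerivAt_homEval_raiseOp hP u s
  simp only [h, map_zero] at hd
  have := is_const_of_deriv_eq_zero (fun s => (hd s).differentiableAt) (fun s => (hd s).deriv) t 0
  simp only [zero_mul, add_zero] at this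
  rw [this]
  congr 2
  ext i j
  fin_cases j <;> rfl

/-- The weight condition `L_z P = 0` says that `P` is homogeneous of degree `nN / 2`. -/
theorem sum_weightOp_eq_zero_iff {w : ℕ} (hw : 2 * w = n * N) (P : MvPolynomial (Fin N) ℂ) :
    ∑ i, (C (-(n : ℂ) / 2) * P + X i * pderiv i P) = 0 ↔ P.IsHomogeneous w := by
  have e : -(n : ℂ) / 2 * N = -(w : ℂ) := by
    have : (2 : ℂ) * w = n * N := by exact_mod_cast hw
    linear_combination this / 2
  rw [IsHomogeneous, IsWeightedHomogeneous, MvPolynomial.ext_iff]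
  refine forall_congr' fun p => ?_
  have e2 : Finsupp.weight 1 p = ∑ i, p i := by
    rw [← Finsupp.degree_eq_sum, Finsupp.degree_eq_weight_one]; rfl
  rw [sum_weightOp_eq, coeff_zero, mul_eq_zero, e, e2, ← Nat.cast_sum, neg_add_eq_zero,
    Nat.cast_inj, eq_comm, or_iff_not_imp_right]

theorem homEval_diagonal {w : ℕ} (hw : 2 * w = n * N) {P : MvPolynomial (Fin N) ℂ}
    (hP : ∀ i, P.degreeOf i ≤ n) (h : P.IsHomogeneous w) (D : Fin 2 → ℂ)
    (u : Fin N → Fin 2 → ℂ) :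
    homEval n (fun i => ![D 0 * u i 0, D 1 * u i 1]) P = (D 0 * D 1) ^ w * homEval n u P := by
  rw [P.as_sum, map_sum, map_sum, Finset.mul_sum]
  refine Finset.sum_congr rfl fun p hp => ?_
  have h1 : ∑ i, p i = w := by
    rw [← Finsupp.degree_eq_sum, Finsupp.degree_eq_weight_one]
    exact h (mem_support_iff.mp hp)
  have h2 : ∑ i, (n - p i) = w := by
    have h3 : ∑ i, (n - p i) + ∑ i, p i = n * N := by
      rw [← Finset.sum_add_distrib, Finset.sum_congr rfl fun i _ =>
        Nat.sub_add_cancel (degreeOf_le_iff.mp (hP i) p hp)]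
      simp [mul_comm]
    omega
  simp only [homEval_monomial, veronese, Matrix.cons_val_zero, Matrix.cons_val_one, mul_pow,
    Finset.prod_mul_distrib, Finset.prod_pow_eq_pow_sum, h1, h2]
  ring

/-- Integrating the `𝔰𝔩₂`-annihilation conditions, over the generators of `GL₂(ℂ)` given by the
diagonal matrices and the transvections. -/
theorem isSemiInv_of_mem_uniformStates {w : ℕ} (hw : 2 * w = n * N)
    {P : MvPolynomial (Fin N) ℂ} (h : P ∈ uniformStates N n) : IsSemiInv n w P := by
  obtain ⟨-, hdeg, hlow, hz, hraise⟩ := mem_uniformStates_iff.mp h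
  rw [sum_weightOp_eq_zero_iff hw] at hz
  intro M hM
  refine Matrix.diagonal_transvection_induction_of_det_ne_zero
    (fun M => ∀ u : Fin N → Fin 2 → ℂ,
      homEval n (fun i => M.mulVec (u i)) P = M.det ^ w * homEval n u P) M hM ?_ ?_ ?_
  · intro D _ u
    rw [Matrix.det_diagonal, Fin.prod_univ_two, ← homEval_diagonal hw hdeg hz]
    congr 2
    ext i j
    rw [Matrix.mulVec_diagonal]
    fin_cases j <;> rfl
  · rintro ⟨i, j, hij, c⟩ u
    rw [Matrix.TransvectionStruct.toMatrix_mk, Matrix.det_transvection_of_ne _ _ hij, one_pow,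
      one_mul]
    have hne : i = 0 ∧ j = 1 ∨ i = 1 ∧ j = 0 := by omega
    rcases hne with ⟨rfl, rfl⟩ | ⟨rfl, rfl⟩
    · rw [← homEval_upper hdeg hlow c u]
      congr 2
      ext i j
      fin_cases j <;> simp [Matrix.transvection, Matrix.mulVec, dotProduct, Fin.sum_univ_two,
        Matrix.single_apply]
    · rw [← homEval_lower hdeg hraise c u]
      congr 2
      ext i j
      fin_cases j <;> simp [Matrix.transvection, Matrix.mulVec, dotProduct, Fin.sum_univ_two,
        Matrix.single_apply, add_comm]
  · intro A B _ _ hA hB u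
    simp only [← Matrix.mulVec_mulVec]
    rw [hA fun i => B.mulVec (u i), hB, Matrix.det_mul, mul_pow, mul_assoc]

/-- Scaling by the single factor `2` detects the degree, as the powers of `2` are distinct. -/
theorem isHomogeneous_of_eval_two_mul {w : ℕ} {P : MvPolynomial (Fin N) ℂ}
    (h : ∀ x : Fin N → ℂ, eval (fun i => 2 * x i) P = 2 ^ w * eval x P) : P.IsHomogeneous w := by
  have h0 : ∑ p ∈ P.support, monomial p ((2 ^ (∑ i, p i) - 2 ^ w) * coeff p P) = 0 := by
    refine MvPolynomial.funext fun x => ?_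
    have := h x
    rw [eval_eq', eval_eq', Finset.mul_sum, ← sub_eq_zero, ← Finset.sum_sub_distrib] at this
    rw [map_zero, ← this, map_sum]
    refine Finset.sum_congr rfl fun p _ => ?_
    rw [eval_monomial, Finsupp.prod_fintype _ _ fun _ => pow_zero _]
    simp only [mul_pow, Finset.prod_mul_distrib, Finset.prod_pow_eq_pow_sum]
    ring
  intro p hp
  have h1 := congrArg (coeff p) h0
  simp only [coeff_sum, coeff_monomial, Finset.sum_ite_eq', mem_support_iff, ne_eq, hp,
    not_false_eq_true, if_true, coeff_zero, mul_eq_zero, or_false] at h1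
  have h2 : (2 : ℕ) ^ (∑ i, p i) = 2 ^ w := by exact_mod_cast sub_eq_zero.mp h1
  rw [← Nat.pow_right_injective le_rfl h2, ← Finsupp.degree_eq_sum, Finsupp.degree_eq_weight_one]
  rfl

/-- Differentiating the `GL₂`-action on a semi-invariant polynomial. -/
theorem mem_uniformStates_of_isSemiInv {w : ℕ} (hw : 2 * w = n * N)
    {P : MvPolynomial (Fin N) ℂ} (hsymm : P.IsSymmetric) (hdeg : ∀ i, P.degreeOf i ≤ n)
    (h : IsSemiInv n w P) : P ∈ uniformStates N n := by
  refine mem_uniformStates_iff.mpr ⟨hsymm, hdeg, ?_, ?_, ?_⟩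
  · refine eq_zero_of_homEval_eq_zero (n := n) fun u => ?_
    have hc : ∀ t : ℂ, homEval n (fun i => ![u i 0 + t * u i 1, u i 1]) P = homEval n u P := by
      intro t
      have := h !![1, t; 0, 1] (by simp) u
      simp only [Matrix.det_fin_two_of, mul_zero, sub_zero, mul_one, one_pow, one_mul] at this
      rw [← this]
      congr 2
      ext i j
      fin_cases j <;> simp [Matrix.mulVec, dotProduct, Fin.sum_univ_two]
    have hd := hasDerivAt_homEval_lowerOp hdeg u 0
    simp only [hc] at hd
    have e : (fun i => ![u i 0 + 0 * u i 1, u i 1]) = u := by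
      ext i j; fin_cases j <;> simp
    rw [e] at hd
    exact hd.unique (hasDerivAt_const _ _)
  · rw [sum_weightOp_eq_zero_iff hw]
    refine isHomogeneous_of_eval_two_mul fun x => ?_
    have := h !![2, 0; 0, 1] (by simp) fun i => ![x i, 1]
    simp only [Matrix.det_fin_two_of, mul_zero, sub_zero, mul_one] at this
    rw [homEval_affine] at this
    rw [← this, ← homEval_affine (n := n)]
    congr 2
    ext i j
    fin_cases j <;> simp [Matrix.mulVec, dotProduct, Fin.sum_univ_two]
  · refine eq_zero_of_homEval_eq_zero (n := n) fun u => ?_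
    have hc : ∀ t : ℂ, homEval n (fun i => ![u i 0, u i 1 + t * u i 0]) P = homEval n u P := by
      intro t
      have := h !![1, 0; t, 1] (by simp) u
      simp only [Matrix.det_fin_two_of, zero_mul, sub_zero, mul_one, one_pow, one_mul] at this
      rw [← this]
      congr 2
      ext i j
      fin_cases j <;> simp [Matrix.mulVec, dotProduct, Fin.sum_univ_two, add_comm]
    have hd := hasDerivAt_homEval_raiseOp hdeg u 0
    simp only [hc] at hd
    have e : (fun i => ![u i 0, u i 1 + 0 * u i 0]) = u := by
      ext i j; fin_cases j <;> simp
    rw [e] at hd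
    exact hd.unique (hasDerivAt_const _ _)

/-! ### Umbral evaluation at sums of points of the rational normal curve -/

@[simp] theorem umbral_monomial {R : Type} [CommRing R] (p : Fin N →₀ ℕ) (c : R) :
    umbral R N (monomial p c) = c • ∏ i, X (p i) := by
  rw [monomial_eq_smul_basisMonomials, map_smul, umbral, Module.Basis.constr_basis]

/-- Umbral evaluation is the `N`-fold tensor power of the functional `zʲ ↦ aⱼ`. If this functional is
a combination of point evaluations, the value expands into values of the multihomogenization. -/
theorem aeval_umbral {A S : Type} [CommRing A] [Algebra ℂ A] [Fintype S]
    (c : S → A) (u : S → Fin 2 → ℂ) (P : MvPolynomial (Fin N) ℂ) :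
    aeval (fun j : ℕ => ∑ s, veronese n (u s) j • c s) (umbral ℂ N P) =
      ∑ f : Fin N → S, homEval n (u ∘ f) P • ∏ i, c (f i) := by
  induction P using MvPolynomial.induction_on' with
  | monomial p b =>
    rw [umbral_monomial, map_smul, map_prod]
    simp only [aeval_X, homEval_monomial, mul_smul, ← Finset.smul_sum]
    rw [Finset.prod_univ_sum, Fintype.piFinset_univ]
    congr 1
    refine Finset.sum_congr rfl fun f _ => ?_
    rw [Finset.prod_smul]
    rfl
  | add P P' h h' => simp only [map_add, h, h', add_smul, Finset.sum_add_distrib]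

theorem aeval_of_inclCoeff_eq {A S : Type} [CommRing A] [Algebra ℂ A] [Fintype S]
    {I : MvPolynomial (Fin (n + 1)) ℂ} {P : MvPolynomial (Fin N) ℂ} {b : ℂ}
    (h : inclCoeff n I = b • umbral ℂ N P) (c : S → A) (u : S → Fin 2 → ℂ) :
    aeval (fun j : Fin (n + 1) => ∑ s, veronese n (u s) j • c s) I =
      b • ∑ f : Fin N → S, homEval n (u ∘ f) P • ∏ i, c (f i) := by
  rw [← aeval_umbral, ← map_smul, ← h, inclCoeff, aeval_rename]
  rfl

theorem binaryForm_veronese (u v : Fin 2 → ℂ) :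
    binaryForm n (fun j => veronese n u j) v = dotProduct u v ^ n := by
  have : dotProduct u v = u 0 * v 0 + u 1 * v 1 := by simp [dotProduct, Fin.sum_univ_two]
  rw [this, add_pow, binaryForm, Finset.sum_range]
  refine Finset.sum_congr rfl fun j _ => ?_
  rw [veronese, mul_pow, mul_pow]
  ring

theorem binaryForm_sum_veronese {S : Type} [Fintype S] (c : S → ℂ) (u : S → Fin 2 → ℂ)
    (v : Fin 2 → ℂ) : binaryForm n (fun j => ∑ s, veronese n (u s) j • c s) v =
      ∑ s, c s * dotProduct (u s) v ^ n := by
  simp only [← binaryForm_veronese, binaryForm, Finset.mul_sum, Finset.sum_mul]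
  rw [Finset.sum_comm]
  refine Finset.sum_congr rfl fun s _ => Finset.sum_congr rfl fun j _ => ?_
  rw [smul_eq_mul]
  ring

/-- A form of degree `n` is determined by its values at the `n + 1` points `(x, 1)`, `0 ≤ x ≤ n`. -/
theorem binaryForm_injective {a b : Fin (n + 1) → ℂ}
    (h : ∀ v, binaryForm n a v = binaryForm n b v) : a = b := by
  have hinj : Function.Injective fun x : Fin (n + 1) => ((x : ℕ) : ℂ) := fun x y hxy =>
    Fin.ext (Nat.cast_injective hxy)
  have h0 : (fun j : Fin (n + 1) => (n.choose j : ℂ) * (a j - b j)) = 0 := by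
    refine Matrix.eq_zero_of_forall_index_sum_pow_mul_eq_zero hinj fun x => ?_
    have := h ![((x : ℕ) : ℂ), 1]
    simp only [binaryForm, Matrix.cons_val_zero, Matrix.cons_val_one, one_pow, mul_one] at this
    rw [← sub_eq_zero, ← Finset.sum_sub_distrib] at this
    rw [← this]
    exact Finset.sum_congr rfl fun j _ => by ring
  funext j
  have h1 := congrFun h0 j
  have h2 : (n.choose j : ℂ) ≠ 0 :=
    Nat.cast_ne_zero.mpr (Nat.choose_pos (Nat.lt_succ_iff.mp j.2)).ne'
  simpa [h2, sub_eq_zero] using h1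

/-- The rational normal curve spans, by the invertibility of Vandermonde matrices. -/
theorem exists_sum_veronese (a : Fin (n + 1) → ℂ) :
    ∃ (c : Fin (n + 1) → ℂ) (u : Fin (n + 1) → Fin 2 → ℂ),
      a = fun j : Fin (n + 1) => ∑ s, veronese n (u s) j • c s := by
  have hinj : Function.Injective fun x : Fin (n + 1) => ((x : ℕ) : ℂ) := fun x y hxy =>
    Fin.ext (Nat.cast_injective hxy)
  have hu : IsUnit (Matrix.vandermonde fun x : Fin (n + 1) => ((x : ℕ) : ℂ)).transpose := by
    rw [Matrix.isUnit_iff_isUnit_det, Matrix.det_transpose, isUnit_iff_ne_zero]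
    exact Matrix.det_vandermonde_ne_zero_iff.mpr hinj
  obtain ⟨c, hc⟩ := Matrix.mulVec_surjective_iff_isUnit.mpr hu a
  refine ⟨c, fun s => ![((s : ℕ) : ℂ), 1], ?_⟩
  rw [← hc]
  funext j
  simp [Matrix.mulVec, dotProduct, veronese, Matrix.vandermonde]

/-- `GL₂(ℂ)` acts on combinations of points of the rational normal curve by moving the points: for
`a = ∑ₛ cₛ ν(uₛ)` the form is `v ↦ ∑ₛ cₛ (uₛ · v)ⁿ`, and `uₛ · M v = Mᵀ uₛ · v`. -/
theorem isInducedAction_sum_veronese {S : Type} [Fintype S] (M : GL (Fin 2) ℂ) (c : S → ℂ)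
    (u : S → Fin 2 → ℂ) : IsInducedAction n M
      (fun j : Fin (n + 1) =>
        ∑ s, veronese n ((M : Matrix (Fin 2) (Fin 2) ℂ).transpose.mulVec (u s)) j • c s)
      (fun j : Fin (n + 1) => ∑ s, veronese n (u s) j • c s) := by
  intro v
  rw [binaryForm_sum_veronese, binaryForm_sum_veronese]
  refine Finset.sum_congr rfl fun s _ => ?_
  rw [Matrix.dotProduct_mulVec, Matrix.mulVec_transpose]

theorem isInvariant_of_isSemiInv {w : ℕ} {I : MvPolynomial (Fin (n + 1)) ℂ}
    {P : MvPolynomial (Fin N) ℂ} {b : ℂ} (h : inclCoeff n I = b • umbral ℂ N P)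
    (hP : IsSemiInv n w P) : IsInvariant n w I := by
  intro M a a' haa'
  obtain ⟨c, u, rfl⟩ := exists_sum_veronese a'
  have ha := binaryForm_injective (a := a) fun v =>
    (haa' v).symm.trans (isInducedAction_sum_veronese M c u v)
  have hM : (M : Matrix (Fin 2) (Fin 2) ℂ).transpose.det ≠ 0 := by
    rw [Matrix.det_transpose]
    exact M.det.ne_zero
  rw [ha, ← coe_aeval_eq_eval, ← coe_aeval_eq_eval]
  simp only [RingHom.coe_coe]
  rw [aeval_of_inclCoeff_eq h, aeval_of_inclCoeff_eq h, smul_eq_mul, smul_eq_mul, mul_left_comm]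
  congr 1
  rw [Finset.mul_sum]
  refine Finset.sum_congr rfl fun f _ => ?_
  have := hP _ hM (u ∘ f)
  rw [Matrix.det_transpose] at this
  rw [smul_eq_mul, smul_eq_mul, ← mul_assoc, ← this]
  rfl

/-- The coefficient of `c₁ ⋯ c_N` in a polynomial in `c₁, …, c_N` that vanishes identically: only
the bijective `f` contribute to it. -/
theorem sum_perm_eq_zero {F : (Fin N → Fin N) → ℂ}
    (h : ∀ c : Fin N → ℂ, ∑ f, F f * ∏ i, c (f i) = 0) : ∑ σ : Equiv.Perm (Fin N), F σ = 0 := by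
  have h0 : ∑ f : Fin N → Fin N, monomial (∑ i, Finsupp.single (f i) 1) (F f) = 0 := by
    refine MvPolynomial.funext fun c => ?_
    rw [map_zero, ← h c, map_sum]
    refine Finset.sum_congr rfl fun f _ => ?_
    rw [monomial_sum_index, map_mul, eval_C, map_prod]
    simp [eval_monomial]
  have h1 : ∀ f : Fin N → Fin N,
      (∑ i, Finsupp.single (f i) 1 = ∑ i, Finsupp.single i 1) ↔ Function.Bijective f := by
    intro f
    constructor
    · intro hf
      refine Finite.surjective_iff_bijective.mp fun j => ?_
      by_contra hj
      push Not at hj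
      have := DFunLike.congr_fun hf j
      simp [Finsupp.finsetSum_apply, Finsupp.single_apply, hj] at this
    · intro hf
      exact (Equiv.ofBijective f hf).sum_comp fun i => Finsupp.single i 1
  have h2 := congrArg (coeff (∑ i, Finsupp.single i 1)) h0
  classical
  simp only [coeff_sum, coeff_monomial, h1, coeff_zero, ← Finset.sum_filter] at h2
  rw [← h2]
  refine Finset.sum_bij (fun σ _ => ⇑σ)
    (fun σ _ => Finset.mem_filter.mpr ⟨Finset.mem_univ _, σ.bijective⟩)
    (fun σ _ τ _ h => DFunLike.coe_injective h) (fun f hf => ?_) fun _ _ => rfl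
  exact ⟨Equiv.ofBijective f (Finset.mem_filter.mp hf).2, Finset.mem_univ _, rfl⟩

theorem homEval_comp_perm {P : MvPolynomial (Fin N) ℂ} (hP : P.IsSymmetric)
    (u : Fin N → Fin 2 → ℂ) (σ : Equiv.Perm (Fin N)) : homEval n (u ∘ σ) P = homEval n u P := by
  rw [← homEval_rename, hP σ]

theorem isSemiInv_of_isInvariant {w : ℕ} {I : MvPolynomial (Fin (n + 1)) ℂ}
    {P : MvPolynomial (Fin N) ℂ} {b : ℂ} (hb : b ≠ 0) (h : inclCoeff n I = b • umbral ℂ N P)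
    (hP : P.IsSymmetric) (hI : IsInvariant n w I) : IsSemiInv n w P := by
  intro M hM u
  have hM' : M.transpose.det ≠ 0 := by rwa [Matrix.det_transpose]
  have key := sum_perm_eq_zero (F := fun f =>
    homEval n (fun i => M.mulVec (u (f i))) P - M.det ^ w * homEval n (u ∘ f) P) fun c => by
      have := hI (Matrix.GeneralLinearGroup.mkOfDetNeZero M.transpose hM') _ _
        (isInducedAction_sum_veronese _ c u)
      rw [← coe_aeval_eq_eval, ← coe_aeval_eq_eval] at this
      simp only [RingHom.coe_coe] at this
      rw [aeval_of_inclCoeff_eq h, aeval_of_inclCoeff_eq h, smul_eq_mul, smul_eq_mul,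
        mul_left_comm, mul_right_inj' hb, Finset.mul_sum, ← sub_eq_zero,
        ← Finset.sum_sub_distrib] at this
      rw [← this]
      refine Finset.sum_congr rfl fun f _ => ?_
      simp only [Matrix.GeneralLinearGroup.mkOfDetNeZero, smul_eq_mul, sub_mul, mul_assoc]
      simp [Function.comp_def]
  have h1 : ∀ σ : Equiv.Perm (Fin N),
      homEval n (fun i => M.mulVec (u (σ i))) P - M.det ^ w * homEval n (u ∘ σ) P =
        homEval n (fun i => M.mulVec (u i)) P - M.det ^ w * homEval n u P := by
    intro σ
    rw [homEval_comp_perm hP, ← homEval_comp_perm hP (fun i => M.mulVec (u i)) σ]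
    rfl
  rw [Finset.sum_congr rfl fun σ _ => h1 σ, Finset.sum_const, smul_eq_zero] at key
  exact sub_eq_zero.mp (key.resolve_left (by simp [Fintype.card_perm, Nat.factorial_ne_zero]))

/-! ### The quantization isomorphism -/

/-- The map `P ↦ 𝓤[P] / N!` into `ℂ[a₀, …, aₙ]`. It has its intended meaning on polynomials of
degree at most `n` in each variable; other exponents are reduced modulo `n + 1`. -/
def quantize (n N : ℕ) : MvPolynomial (Fin N) ℂ →ₗ[ℂ] MvPolynomial (Fin (n + 1)) ℂ :=
  (N.factorial : ℂ)⁻¹ •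
    (basisMonomials (Fin N) ℂ).constr ℂ fun p => ∏ i, X (Fin.ofNat (n + 1) (p i))

theorem quantize_monomial (p : Fin N →₀ ℕ) (c : ℂ) :
    quantize n N (monomial p c) =
      (N.factorial : ℂ)⁻¹ • c • ∏ i, X (Fin.ofNat (n + 1) (p i)) := by
  rw [monomial_eq_smul_basisMonomials, map_smul, quantize, LinearMap.smul_apply,
    Module.Basis.constr_basis, smul_comm]

theorem inclCoeff_quantize {P : MvPolynomial (Fin N) ℂ} (hP : ∀ i, P.degreeOf i ≤ n) :
    inclCoeff n (quantize n N P) = (N.factorial : ℂ)⁻¹ • umbral ℂ N P := by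
  refine induction_of_degreeOf_le (motive := fun P =>
    inclCoeff n (quantize n N P) = (N.factorial : ℂ)⁻¹ • umbral ℂ N P) hP
    (fun p c hp => ?_) (by simp) fun P P' h h' => ?_
  · rw [quantize_monomial, umbral_monomial, map_smul, map_smul, map_prod]
    congr 2
    refine Finset.prod_congr rfl fun i _ => ?_
    rw [inclCoeff, rename_X]
    congr 1
    exact Nat.mod_eq_of_lt (Nat.lt_succ_of_le (hp i))
  · simp only [map_add, smul_add, h, h']

theorem quantize_isHomogeneous (P : MvPolynomial (Fin N) ℂ) :
    (quantize n N P).IsHomogeneous N := by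
  induction P using MvPolynomial.induction_on' with
  | monomial p c =>
    rw [quantize_monomial]
    refine (homogeneousSubmodule _ _ N).smul_mem _ ((homogeneousSubmodule _ _ N).smul_mem _ ?_)
    have := IsHomogeneous.prod Finset.univ (fun i : Fin N => (X (Fin.ofNat (n + 1) (p i)) :
      MvPolynomial (Fin (n + 1)) ℂ)) (fun _ => 1) fun i _ => isHomogeneous_X _ _
    simpa using this
  | add P P' h h' => rw [map_add]; exact h.add h'

theorem quantize_rename (σ : Equiv.Perm (Fin N)) (P : MvPolynomial (Fin N) ℂ) :
    quantize n N (rename σ P) = quantize n N P := by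
  induction P using MvPolynomial.induction_on' with
  | monomial p c =>
    rw [rename_monomial, quantize_monomial, quantize_monomial]
    congr 2
    refine (Fintype.prod_equiv σ _ _ fun i => ?_).symm
    rw [Finsupp.mapDomain_apply σ.injective]
  | add P P' h h' => rw [map_add, map_add, map_add, h, h']

theorem quantize_symmetrize (P : MvPolynomial (Fin N) ℂ) :
    quantize n N (symmetrize N P) = (N.factorial : ℂ) • quantize n N P := by
  rw [symmetrize, map_sum, Finset.sum_congr rfl fun σ _ => quantize_rename σ P, Finset.sum_const,
    Finset.card_univ, Fintype.card_perm, Fintype.card_fin, Nat.cast_smul_eq_nsmul]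

theorem symmetrize_isSymmetric (P : MvPolynomial (Fin N) ℂ) : (symmetrize N P).IsSymmetric := by
  intro σ
  rw [symmetrize, map_sum]
  refine Fintype.sum_equiv (Equiv.mulLeft σ) _ _ fun τ => ?_
  rw [rename_rename]
  rfl

theorem degreeOf_symmetrize_le {P : MvPolynomial (Fin N) ℂ} (hP : ∀ i, P.degreeOf i ≤ n)
    (i : Fin N) : (symmetrize N P).degreeOf i ≤ n := by
  refine (degreeOf_sum_le i _ _).trans (Finset.sup_le fun σ _ => ?_)
  rw [← σ.apply_symm_apply i, degreeOf_rename_of_injective σ.injective]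
  exact hP _

theorem eq_zero_of_quantize_eq_zero {P : MvPolynomial (Fin N) ℂ} (hsymm : P.IsSymmetric)
    (hdeg : ∀ i, P.degreeOf i ≤ n) (h : quantize n N P = 0) : P = 0 := by
  refine eq_zero_of_homEval_eq_zero (n := n) fun u => ?_
  have hN : (N.factorial : ℂ) ≠ 0 := Nat.cast_ne_zero.mpr N.factorial_ne_zero
  have key := sum_perm_eq_zero (F := fun f => homEval n (u ∘ f) P) fun c => by
    have := aeval_of_inclCoeff_eq (inclCoeff_quantize hdeg) c u
    rw [h, map_zero, eq_comm, smul_eq_zero] at this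
    exact this.resolve_left (inv_ne_zero hN)
  rw [Finset.sum_congr rfl fun σ _ => homEval_comp_perm hsymm u σ, Finset.sum_const,
    smul_eq_zero] at key
  exact key.resolve_left (by simp [Fintype.card_perm, Nat.factorial_ne_zero])

theorem exists_prod_X_eq_monomial {τ : Type} {p : τ →₀ ℕ} (hp : p.degree = N) :
    ∃ f : Fin N → τ, ∏ i, (X (f i) : MvPolynomial τ ℂ) = monomial p 1 := by
  induction N generalizing p with
  | zero => exact ⟨Fin.elim0, by rw [(Finsupp.degree_eq_zero_iff p).mp hp]; simp⟩
  | succ N ih =>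
    obtain ⟨j, hj⟩ : ∃ j, p j ≠ 0 := by
      by_contra! h
      have : p = 0 := Finsupp.ext h
      simp [this] at hp
    have hle : Finsupp.single j 1 ≤ p := Finsupp.single_le_iff.mpr (Nat.one_le_iff_ne_zero.mpr hj)
    obtain ⟨f, hf⟩ := ih (p := p - Finsupp.single j 1) <| by
      have := congrArg Finsupp.degree (add_tsub_cancel_of_le hle)
      rw [map_add, Finsupp.degree_single, hp] at this
      omega
    refine ⟨Fin.cons j f, ?_⟩
    rw [Fin.prod_univ_succ]
    simp only [Fin.cons_zero, Fin.cons_succ, hf]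
    rw [X, monomial_mul, one_mul, add_tsub_cancel_of_le hle]

theorem exists_quantize_eq {I : MvPolynomial (Fin (n + 1)) ℂ} (hI : I.IsHomogeneous N) :
    ∃ P : MvPolynomial (Fin N) ℂ, P.IsSymmetric ∧ (∀ i, P.degreeOf i ≤ n) ∧
      quantize n N P = I := by
  have hN : (N.factorial : ℂ) ≠ 0 := Nat.cast_ne_zero.mpr N.factorial_ne_zero
  -- the preimage of a monomial is the symmetrization of a monomial
  have hmono : ∀ p ∈ I.support, ∃ P : MvPolynomial (Fin N) ℂ, (∀ i, P.degreeOf i ≤ n) ∧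
      quantize n N (symmetrize N P) = monomial p (coeff p I) := by
    intro p hp
    obtain ⟨f, hf⟩ := exists_prod_X_eq_monomial (N := N) (p := p) <| by
      rw [Finsupp.degree_eq_weight_one]
      exact hI (mem_support_iff.mp hp)
    refine ⟨monomial (Finsupp.equivFunOnFinite.symm fun i => (f i : ℕ)) (coeff p I),
      fun i => ?_, ?_⟩
    · refine degreeOf_le_iff.mpr fun q hq => ?_
      rw [Finset.mem_singleton.mp (support_monomial_subset hq)]
      exact Nat.lt_succ_iff.mp (Fin.is_lt _)
    · rw [quantize_symmetrize, quantize_monomial, smul_inv_smul₀ hN]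
      have : ∀ i, Fin.ofNat (n + 1) (f i) = f i := fun i =>
        Fin.ext (Nat.mod_eq_of_lt (f i).is_lt)
      simp only [Finsupp.equivFunOnFinite_symm_apply_apply, this]
      rw [hf, smul_monomial, smul_eq_mul, mul_one]
  choose! P hP1 hP2 using hmono
  refine ⟨∑ p ∈ I.support, symmetrize N (P p), ?_, fun i => ?_, ?_⟩
  · intro σ
    rw [map_sum]
    exact Finset.sum_congr rfl fun p _ => symmetrize_isSymmetric _ σ
  · exact (degreeOf_sum_le i _ _).trans
      (Finset.sup_le fun p hp => degreeOf_symmetrize_le (hP1 p hp) i)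
  · rw [map_sum, Finset.sum_congr rfl hP2, ← I.as_sum]

theorem quantize_mem_invariants {w : ℕ} (hw : 2 * w = n * N) {P : MvPolynomial (Fin N) ℂ}
    (hP : P ∈ uniformStates N n) : quantize n N P ∈ invariants n N :=
  ⟨quantize_isHomogeneous P, w, isInvariant_of_isSemiInv (inclCoeff_quantize hP.2.1)
    (isSemiInv_of_mem_uniformStates hw hP)⟩

/-- The quantization isomorphism from uniform states to invariants of binary forms. -/
def quantizeEquiv {w : ℕ} (hw : 2 * w = n * N) : uniformStates N n ≃ₗ[ℂ] invariants n N :=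
  LinearEquiv.ofBijective
    (((quantize n N).domRestrict (uniformStates N n)).codRestrict (invariants n N)
      fun P => quantize_mem_invariants hw P.2) <| by
    constructor
    · refine (injective_iff_map_eq_zero _).mpr fun P h => Subtype.ext ?_
      exact eq_zero_of_quantize_eq_zero P.2.1 P.2.2.1 (congrArg Subtype.val h)
    · rintro ⟨I, hI, w', hw'⟩
      obtain ⟨P, hsymm, hdeg, rfl⟩ := exists_quantize_eq hI
      have hP : P ∈ uniformStates N n := by
        by_cases h0 : quantize n N P = 0
        · rw [eq_zero_of_quantize_eq_zero hsymm hdeg h0]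
          exact zero_mem _
        · exact mem_uniformStates_of_isSemiInv (weight_eq h0 hI hw') hsymm hdeg
            (isSemiInv_of_isInvariant
              (inv_ne_zero (Nat.cast_ne_zero.mpr N.factorial_ne_zero))
              (inclCoeff_quantize hdeg) hsymm hw')
      exact ⟨⟨P, hP⟩, rfl⟩

theorem coe_quantizeEquiv {w : ℕ} (hw : 2 * w = n * N) (P : uniformStates N n) :
    (quantizeEquiv hw P : MvPolynomial (Fin (n + 1)) ℂ) = quantize n N P := rfl

/-! ### Evaluation at the three points `∞, 1, 0` -/

/-- Representatives in `ℂ²` of the points `0, 1, ∞` of the projective line, which are the colors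
`0, 1, 2`. -/
def colorPoint : Fin 3 → Fin 2 → ℂ := ![![0, 1], ![1, 1], ![1, 0]]

/-- The transpositions of the three points are induced by matrices of determinant `-1`, up to signs
of the representatives. -/
theorem exists_matrix_swap (x y : Fin 3) (hxy : x ≠ y) :
    ∃ (M : Matrix (Fin 2) (Fin 2) ℂ) (ε : Fin 3 → ℂ), M.det = -1 ∧ (∀ c, ε c ^ 2 = 1) ∧
      ∀ c, M.mulVec (colorPoint c) = ε c • colorPoint (Equiv.swap x y c) := by
  have h02 : ∀ c, (!![0, 1; 1, 0] : Matrix (Fin 2) (Fin 2) ℂ).mulVec (colorPoint c) =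
      (![1, 1, 1] : Fin 3 → ℂ) c • colorPoint (Equiv.swap 0 2 c) := by
    have h1 : Equiv.swap (0 : Fin 3) 2 1 = 1 := by decide
    intro c
    ext j
    fin_cases c <;> fin_cases j <;> simp [colorPoint, h1]
  have h12 : ∀ c, (!![1, 0; 1, -1] : Matrix (Fin 2) (Fin 2) ℂ).mulVec (colorPoint c) =
      (![-1, 1, 1] : Fin 3 → ℂ) c • colorPoint (Equiv.swap 1 2 c) := by
    have h1 : Equiv.swap (1 : Fin 3) 2 0 = 0 := by decide
    intro c
    ext j
    fin_cases c <;> fin_cases j <;> simp [colorPoint, h1]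
  have h01 : ∀ c, (!![-1, 1; 0, 1] : Matrix (Fin 2) (Fin 2) ℂ).mulVec (colorPoint c) =
      (![1, 1, -1] : Fin 3 → ℂ) c • colorPoint (Equiv.swap 0 1 c) := by
    have h1 : Equiv.swap (0 : Fin 3) 1 2 = 2 := by decide
    intro c
    ext j
    fin_cases c <;> fin_cases j <;> simp [colorPoint, h1]
  have e02 : ∀ c, (![1, 1, 1] : Fin 3 → ℂ) c ^ 2 = 1 := by intro c; fin_cases c <;> simp
  have e12 : ∀ c, (![-1, 1, 1] : Fin 3 → ℂ) c ^ 2 = 1 := by intro c; fin_cases c <;> simp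
  have e01 : ∀ c, (![1, 1, -1] : Fin 3 → ℂ) c ^ 2 = 1 := by intro c; fin_cases c <;> simp
  have key : ∀ x y : Fin 3, x < y →
    ∃ (M : Matrix (Fin 2) (Fin 2) ℂ) (ε : Fin 3 → ℂ), M.det = -1 ∧ (∀ c, ε c ^ 2 = 1) ∧
      ∀ c, M.mulVec (colorPoint c) = ε c • colorPoint (Equiv.swap x y c) := by
    intro x y hxy
    have : x = 0 ∧ y = 2 ∨ x = 1 ∧ y = 2 ∨ x = 0 ∧ y = 1 := by omega
    rcases this with ⟨rfl, rfl⟩ | ⟨rfl, rfl⟩ | ⟨rfl, rfl⟩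
    · exact ⟨_, _, by simp, e02, h02⟩
    · exact ⟨_, _, by simp, e12, h12⟩
    · exact ⟨_, _, by simp, e01, h01⟩
  rcases lt_or_gt_of_ne hxy with h | h
  · exact key x y h
  · rw [Equiv.swap_comm]
    exact key y x h

theorem homEval_colorPoint_perm {P : MvPolynomial (Fin N) ℂ} (hdeg : ∀ i, P.degreeOf i ≤ 2 * r)
    (hP : IsSemiInv (2 * r) w P) (τ : Equiv.Perm (Fin 3)) (f : Fin N → Fin 3) :
    homEval (2 * r) (fun i => colorPoint (τ (f i))) P =
      ((Equiv.Perm.sign τ : ℤ) : ℂ) ^ w * homEval (2 * r) (fun i => colorPoint (f i)) P := by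
  induction τ using Equiv.Perm.swap_induction_on with
  | one => simp
  | swap_mul τ x y hxy ih =>
    obtain ⟨M, ε, hM, hε, h⟩ := exists_matrix_swap x y hxy
    have h1 := hP M (by simp [hM]) fun i => colorPoint (τ (f i))
    simp only [h] at h1
    rw [homEval_smul hdeg, ih, hM] at h1
    simp only [pow_mul, hε, one_pow, Finset.prod_const_one, one_mul] at h1
    simp only [Equiv.Perm.mul_apply, h1, Equiv.Perm.sign_mul, Equiv.Perm.sign_swap hxy]
    push_cast
    rw [neg_one_mul, neg_pow ((Equiv.Perm.sign τ : ℤ) : ℂ), mul_assoc]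

theorem colorCount_perm (τ : Equiv.Perm (Fin 3)) (f : Fin N → Fin 3) (c : Fin 3) :
    colorCount (fun i => τ (f i)) (τ c) = colorCount f c := by
  simp [colorCount]

theorem homEval_colorPoint_eq_zero_of_two {P : MvPolynomial (Fin N) ℂ} (hr : 1 ≤ r)
    (hdeg : ∀ i, P.degreeOf i ≤ 2 * r) (hP : IsSemiInv (2 * r) (r * N) P) {f : Fin N → Fin 3}
    (hf : N < 2 * colorCount f 2) : homEval (2 * r) (fun i => colorPoint (f i)) P = 0 := by
  -- contract the points `0` and `1` to each other, away from `∞`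
  set v : ℂ → Fin 3 → Fin 2 → ℂ := fun l => ![![0, 1], ![l, 1], ![1, 0]] with hv
  -- `e` is the exponent of `l` that is left after cancelling the weight; it is positive
  obtain ⟨e, he, he0⟩ : ∃ e, 2 * r * colorCount f 2 = r * N + e ∧ e ≠ 0 := by
    have : r * N < r * (2 * colorCount f 2) := Nat.mul_lt_mul_of_pos_left hf hr
    exact ⟨2 * r * colorCount f 2 - r * N, by lia, by lia⟩
  have key : ∀ l : ℂ, l ≠ 0 → l ^ e * homEval (2 * r) (fun i => v l (f i)) P =
      homEval (2 * r) (fun i => colorPoint (f i)) P := by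
    intro l hl
    have h1 := hP !![l, 0; 0, 1] (by simpa using hl) fun i => colorPoint (f i)
    have h2 : ∀ c, (!![l, 0; 0, 1] : Matrix (Fin 2) (Fin 2) ℂ).mulVec (colorPoint c) =
        (if c = 2 then l else 1) • v l c := by
      intro c
      ext j
      fin_cases c <;> fin_cases j <;> simp [colorPoint, hv]
    simp only [h2] at h1
    rw [homEval_smul hdeg, Finset.prod_pow, Finset.prod_ite, Finset.prod_const,
      Finset.prod_const_one, mul_one, ← pow_mul, mul_comm _ (2 * r), Matrix.det_fin_two_of,
      mul_one, mul_zero, sub_zero] at h1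
    rw [show (Finset.univ.filter fun i => f i = 2).card = colorCount f 2 from rfl, he, pow_add,
      mul_assoc] at h1
    exact mul_left_cancel₀ (pow_ne_zero _ hl) h1
  have hcont : Continuous fun l : ℂ => l ^ e * homEval (2 * r) (fun i => v l (f i)) P := by
    refine (continuous_pow e).mul ((continuous_homEval P).comp (continuous_pi fun i => ?_))
    have : ∀ c, Continuous fun l => v l c := by
      intro c
      refine continuous_pi fun j => ?_
      fin_cases c <;> fin_cases j <;> simp [hv] <;> fun_prop
    exact this (f i)
  have h0 := (hcont.tendsto 0).mono_left (nhdsWithin_le_nhds (s := {0}ᶜ))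
  rw [zero_pow he0, zero_mul] at h0
  refine tendsto_nhds_unique (tendsto_const_nhds.congr' ?_) h0
  filter_upwards [self_mem_nhdsWithin] with l hl
  exact (key l hl).symm

/-- A semi-invariant polynomial vanishes where more than half of its arguments coincide. -/
theorem homEval_colorPoint_eq_zero {P : MvPolynomial (Fin N) ℂ} (hr : 1 ≤ r)
    (hdeg : ∀ i, P.degreeOf i ≤ 2 * r) (hP : IsSemiInv (2 * r) (r * N) P) {f : Fin N → Fin 3}
    {c : Fin 3} (hf : N < 2 * colorCount f c) :
    homEval (2 * r) (fun i => colorPoint (f i)) P = 0 := by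
  have h := homEval_colorPoint_perm hdeg hP (Equiv.swap c 2) f
  have hc := colorCount_perm (Equiv.swap c 2) f c
  rw [Equiv.swap_apply_left] at hc
  rw [homEval_colorPoint_eq_zero_of_two hr hdeg hP (by rwa [hc])] at h
  exact (mul_eq_zero.mp h.symm).resolve_left (pow_ne_zero _ (by simp))

theorem sum_colorCount (f : Fin N → Fin 3) : ∑ c, colorCount f c = N := by
  have := Finset.card_eq_sum_card_fiberwise (s := Finset.univ) (t := Finset.univ) (f := f)
    fun _ _ => Finset.mem_coe.mpr (Finset.mem_univ _)
  rw [Finset.card_univ, Fintype.card_fin] at this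
  exact this.symm

theorem fracMonomial_mul (e e' : Fin 3 → ℚ) :
    fracMonomial e * fracMonomial e' = fracMonomial (e + e') := by
  rw [fracMonomial, fracMonomial, AddMonoidAlgebra.single_mul_single, one_mul, fracMonomial]

theorem fracMonomial_zero : fracMonomial 0 = 1 := rfl

theorem prod_fracMonomial {ι : Type} (s : Finset ι) (e : ι → Fin 3 → ℚ) :
    ∏ i ∈ s, fracMonomial (e i) = fracMonomial (∑ i ∈ s, e i) := by
  classical
  induction s using Finset.induction_on with
  | empty => rfl
  | insert i s hi ih => rw [Finset.prod_insert hi, Finset.sum_insert hi, ih, fracMonomial_mul]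

theorem fracMonomial_pow (e : Fin 3 → ℚ) (m : ℕ) : fracMonomial e ^ m = fracMonomial (m • e) := by
  rw [fracMonomial, AddMonoidAlgebra.single_pow, one_pow, fracMonomial]

theorem toFrac_prod_pow (t : Fin 3 → ℕ) :
    toFrac (∏ d, X d ^ t d) = fracMonomial fun d => (t d : ℚ) := by
  simp only [toFrac, map_prod, map_pow, aeval_X, fracMonomial_pow, prod_fracMonomial]
  congr 1
  ext d
  simp [Finset.sum_apply, Pi.single_apply]

theorem toFrac_injective : Function.Injective toFrac := by
  have hinj : Function.Injective fun (t : Fin 3 →₀ ℕ) (d : Fin 3) => (t d : ℚ) := by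
    intro t t' h
    ext d
    exact Nat.cast_injective (congrFun h d)
  have h : ∀ p, toFrac p =
      AddMonoidAlgebra.mapDomain (fun (t : Fin 3 →₀ ℕ) (d : Fin 3) => (t d : ℚ)) p := by
    intro p
    induction p using MvPolynomial.induction_on' with
    | monomial t c =>
      have : (monomial t c : MvPolynomial (Fin 3) ℂ) = c • ∏ d, X d ^ t d := by
        rw [monomial_eq, Finsupp.prod_fintype _ _ fun _ => pow_zero _, smul_eq_C_mul]
      rw [this, map_smul, toFrac_prod_pow, ← this]
      refine Eq.trans ?_ (AddMonoidAlgebra.mapDomain_single).symm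
      rw [fracMonomial, AddMonoidAlgebra.smul_single, smul_eq_mul, mul_one]
    | add p q hp hq =>
      rw [map_add, hp, hq]
      exact (AddMonoidAlgebra.mapDomain_add _ _ _).symm
  intro p q hpq
  rw [h, h] at hpq
  exact AddMonoidAlgebra.mapDomain_injective hinj hpq

/-- Evaluation of a polynomial in the coefficients of a binary form at the form
`s (z ↦ ∞) + t (z ↦ 1) + u (z ↦ 0)`, a combination of three point evaluations, with
`s = √(YZ/X)`, `t = √(XZ/Y)` and `u = √(XY/Z)`. -/
def triEval (n : ℕ) : MvPolynomial ℕ ℂ →ₐ[ℂ] FracPoly :=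
  aeval fun j => ∑ c : Fin 3, veronese n (colorPoint c) j •
    fracMonomial fun d => 1 / 2 - if c = d.rev then 1 else 0

theorem triEval_umbral (P : MvPolynomial (Fin N) ℂ) :
    triEval n (umbral ℂ N P) = ∑ f : Fin N → Fin 3, homEval n (fun i => colorPoint (f i)) P •
      fracMonomial fun d => (N : ℚ) / 2 - colorCount f d.rev := by
  rw [triEval, aeval_umbral]
  refine Finset.sum_congr rfl fun f _ => ?_
  rw [prod_fracMonomial]
  congr 2
  ext d
  simp only [Finset.sum_apply, Finset.sum_sub_distrib, colorCount]
  simp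
  ring

/-- The polynomial part of `triEval`, on umbral evaluations of semi-invariant polynomials; the
exponents are natural numbers, with truncated subtraction and `N / 2` rounded down. -/
def triPoly (n : ℕ) (P : MvPolynomial (Fin N) ℂ) : MvPolynomial (Fin 3) ℂ :=
  ∑ f : Fin N → Fin 3, homEval n (fun i => colorPoint (f i)) P •
    ∏ d : Fin 3, X d ^ (N / 2 - colorCount f d.rev)

theorem triEval_umbral_eq_toFrac {P : MvPolynomial (Fin N) ℂ} (hr : 1 ≤ r)
    (hdeg : ∀ i, P.degreeOf i ≤ 2 * r) (hP : IsSemiInv (2 * r) (r * N) P) :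
    triEval (2 * r) (umbral ℂ N P) =
      fracMonomial (fun _ => (N : ℚ) / 2 - (N / 2 : ℕ)) * toFrac (triPoly (2 * r) P) := by
  rw [triEval_umbral, triPoly, map_sum, Finset.mul_sum]
  refine Finset.sum_congr rfl fun f _ => ?_
  by_cases hf : ∀ c, 2 * colorCount f c ≤ N
  · rw [map_smul, toFrac_prod_pow, mul_smul_comm, fracMonomial_mul]
    congr 2
    ext d
    have : colorCount f d.rev ≤ N / 2 := by have := hf d.rev; omega
    rw [Pi.add_apply, Nat.cast_sub this]
    ring
  · push Not at hf
    obtain ⟨c, hc⟩ := hf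
    simp [homEval_colorPoint_eq_zero hr hdeg hP hc]

theorem rename_triPoly {P : MvPolynomial (Fin N) ℂ} (hdeg : ∀ i, P.degreeOf i ≤ 2 * r)
    (hP : IsSemiInv (2 * r) w P) (σ : Equiv.Perm (Fin 3)) :
    rename σ (triPoly (2 * r) P) =
      ((Equiv.Perm.sign σ : ℤ) : ℂ) ^ w • triPoly (2 * r) P := by
  rw [triPoly, map_sum, Finset.smul_sum]
  -- the permutation of the colors that corresponds to `σ`
  set τ : Equiv.Perm (Fin 3) := Fin.revPerm.permCongr σ with hτ
  have hsign : Equiv.Perm.sign τ = Equiv.Perm.sign σ := Equiv.Perm.sign_permCongr _ _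
  refine Fintype.sum_equiv (Equiv.piCongrRight fun _ => τ) _ _ fun f => ?_
  have h1 : (Equiv.piCongrRight fun _ => τ) f = fun i => τ (f i) := rfl
  rw [h1, map_smul, map_prod]
  have h2 := homEval_colorPoint_perm hdeg hP τ f
  have h3 : ((Equiv.Perm.sign σ : ℤ) : ℂ) ^ w * ((Equiv.Perm.sign σ : ℤ) : ℂ) ^ w = 1 := by
    rw [← mul_pow, ← Int.cast_mul, ← Units.val_mul, Int.units_mul_self]
    simp
  rw [h2, hsign, smul_smul, ← mul_assoc, h3, one_mul]
  congr 1
  refine Fintype.prod_equiv σ _ _ fun d => ?_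
  rw [map_pow, rename_X]
  congr 2
  rw [← colorCount_perm τ f]
  simp [hτ]

/-! ### Three-point specializations and their generating function -/

/-- The coloring of `1, …, 2k` by the blocks of `threePoint k a b`. -/
def blockColoring (k a b : ℕ) (i : Fin (2 * k)) : Fin 3 :=
  if (i : ℕ) < k - a then 2 else if (i : ℕ) < (k - a) + (k - b) then 1 else 0

theorem colorCount_blockColoring (t : Fin 3 → ℕ) (ht : ∑ d, t d = k) (d : Fin 3) :
    colorCount (blockColoring k (t 0) (t 1)) d.rev = k - t d := by
  rw [Fin.sum_univ_three] at ht
  have h2 : colorCount (blockColoring k (t 0) (t 1)) 2 = k - t 0 := by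
    have : ∀ i, blockColoring k (t 0) (t 1) i = 2 ↔ (i : ℕ) < k - t 0 := by
      intro i
      unfold blockColoring
      split_ifs <;> simp_all
    simp only [colorCount, this]
    rw [Fin.card_filter_val_lt]
    omega
  have h0 : colorCount (blockColoring k (t 0) (t 1)) 0 = k - t 2 := by
    have : ∀ i, blockColoring k (t 0) (t 1) i = 0 ↔ ¬ (i : ℕ) < (k - t 0) + (k - t 1) := by
      intro i
      unfold blockColoring
      split_ifs <;> simp_all; omega
    simp only [colorCount, this]
    rw [Finset.filter_not, Finset.card_sdiff_of_subset (Finset.filter_subset _ _),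
      Fin.card_filter_val_lt, Finset.card_univ, Fintype.card_fin]
    omega
  have hs := sum_colorCount (blockColoring k (t 0) (t 1))
  rw [Fin.sum_univ_three, h0, h2] at hs
  fin_cases d
  · exact h2
  · change colorCount _ 1 = k - t 1
    omega
  · exact h0

/-- Dividing by `w ^ (2r(k - a))` rescales the representatives `(w, 1)` to `(1, 1/w)`, which tend to
the point `∞`. -/
theorem tendsto_specFun {P : MvPolynomial (Fin (2 * k)) ℂ} (hdeg : ∀ i, P.degreeOf i ≤ 2 * r)
    {a b c : ℕ} (habc : a + b + c = k) :
    Filter.Tendsto (specFun r k P a b) (Bornology.cobounded ℂ)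
      (nhds (homEval (2 * r) (fun i => colorPoint (blockColoring k a b i)) P)) := by
  set v : ℂ → Fin 3 → Fin 2 → ℂ := fun z => ![![0, 1], ![1, 1], ![1, z]] with hv
  have hcont : Continuous fun z : ℂ =>
      homEval (2 * r) (fun i => v z (blockColoring k a b i)) P := by
    refine (continuous_homEval P).comp (continuous_pi fun i => ?_)
    have : ∀ c, Continuous fun z => v z c := by
      intro c
      refine continuous_pi fun j => ?_
      fin_cases c <;> fin_cases j <;> simp [hv] <;> fun_prop
    exact this _
  have h0 : v 0 = colorPoint := rfl
  have hlim := (hcont.tendsto 0).comp (Filter.tendsto_inv₀_cobounded (α := ℂ))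
  rw [h0] at hlim
  refine hlim.congr' ?_
  filter_upwards [Bornology.eventually_ne_cobounded (0 : ℂ)] with z hz
  have hp : ∀ i, (![threePoint k a b z i, 1] : Fin 2 → ℂ) =
      (if blockColoring k a b i = 2 then z else 1) • v z⁻¹ (blockColoring k a b i) := by
    intro i
    ext j
    unfold blockColoring threePoint
    split_ifs <;> fin_cases j <;> simp_all
  have hcard : colorCount (blockColoring k a b) 2 = k - a :=
    colorCount_blockColoring ![a, b, c] (by simpa [Fin.sum_univ_three] using habc) 0
  rw [Function.comp, specFun, ← homEval_affine (n := 2 * r)]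
  simp only [hp]
  rw [homEval_smul hdeg, Finset.prod_pow, Finset.prod_ite, Finset.prod_const,
    Finset.prod_const_one, mul_one, ← pow_mul, mul_comm _ (2 * r),
    show (Finset.univ.filter fun i => blockColoring k a b i = 2).card = k - a from hcard,
    inv_mul_cancel_left₀ (pow_ne_zero _ hz)]

theorem spec_eq {P : MvPolynomial (Fin (2 * k)) ℂ} (hdeg : ∀ i, P.degreeOf i ≤ 2 * r)
    {a b c : ℕ} (habc : a + b + c = k) :
    spec r k P a b = homEval (2 * r) (fun i => colorPoint (blockColoring k a b i)) P :=
  (tendsto_specFun hdeg habc).limUnder_eq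

/-- Colorings with the same color counts differ by a permutation of the nodes. -/
theorem exists_perm_of_colorCount_eq {f g : Fin N → Fin 3}
    (h : ∀ c, colorCount g c = colorCount f c) : ∃ σ : Equiv.Perm (Fin N), f ∘ σ = g := by
  have e : ∀ c, Nonempty ({i // g i = c} ≃ {i // f i = c}) := fun c => by
    refine ⟨Fintype.equivOfCardEq ?_⟩
    rw [Fintype.card_subtype, Fintype.card_subtype]
    exact h c
  exact ⟨Equiv.ofFiberEquiv fun c => (e c).some, funext fun i => Equiv.ofFiberEquiv_map _ i⟩

/-- Orbit counting: the number of colorings with prescribed color counts. -/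
theorem card_colorCount_eq_mul_prod_factorial (f : Fin N → Fin 3) :
    (Finset.univ.filter fun g : Fin N → Fin 3 => ∀ c, colorCount g c = colorCount f c).card *
      ∏ c, (colorCount f c).factorial = N.factorial := by
  classical
  have hmaps : ∀ σ ∈ (Finset.univ : Finset (Equiv.Perm (Fin N))), f ∘ σ ∈
      Finset.univ.filter fun g : Fin N → Fin 3 => ∀ c, colorCount g c = colorCount f c := by
    intro σ _
    refine Finset.mem_filter.mpr ⟨Finset.mem_univ _, fun c => ?_⟩
    exact Finset.card_equiv σ (by simp)
  have h := Finset.card_eq_sum_card_fiberwise hmaps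
  rw [Finset.card_univ, Fintype.card_perm, Fintype.card_fin] at h
  rw [h, Finset.sum_const_nat]
  intro g hg
  obtain ⟨τ, rfl⟩ := exists_perm_of_colorCount_eq (Finset.mem_filter.mp hg).2
  have h1 := DomMulAct.stabilizer_card f
  simp only [Fintype.card_subtype] at h1
  refine Eq.trans ?_ h1
  refine Finset.card_equiv (Equiv.mulRight τ⁻¹) fun σ => ?_
  simp only [Finset.mem_filter, Finset.mem_univ, true_and, Equiv.coe_mulRight]
  constructor
  · intro hσ
    rw [Equiv.Perm.coe_mul, ← Function.comp_assoc, hσ, Function.comp_assoc, ← Equiv.Perm.coe_mul]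
    simp
  · intro hσ
    conv_rhs => rw [← hσ]
    rw [Function.comp_assoc, ← Equiv.Perm.coe_mul]
    simp

/-- Collecting the colorings with the same color counts. -/
theorem triPoly_eq_smul_genFun {P : MvPolynomial (Fin (2 * k)) ℂ} (hr : 1 ≤ r)
    (hsymm : P.IsSymmetric) (hdeg : ∀ i, P.degreeOf i ≤ 2 * r)
    (hP : IsSemiInv (2 * r) (r * (2 * k)) P) :
    triPoly (2 * r) P = ((2 * k).factorial : ℂ) • genFun r k P := by
  have hk : 2 * k / 2 = k := by omega
  rw [triPoly, hk, genFun, Finset.smul_sum]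
  rw [← Finset.sum_filter_of_ne (p := fun f : Fin (2 * k) → Fin 3 => ∀ c, colorCount f c ≤ k)
    fun f _ hf => by
      contrapose! hf
      obtain ⟨c, hc⟩ := hf
      rw [homEval_colorPoint_eq_zero hr hdeg hP (f := f) (c := c) (by omega), zero_smul]]
  rw [← Finset.sum_fiberwise_of_maps_to (g := fun f d => k - colorCount f (Fin.rev d))
    (t := Finset.Nat.antidiagonalTuple 3 k)]
  · refine Finset.sum_congr rfl fun t ht => ?_
    rw [Finset.Nat.mem_antidiagonalTuple] at ht
    have ht' := ht
    rw [Fin.sum_univ_three] at ht'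
    have hle : ∀ d, t d ≤ k := by intro d; fin_cases d <;> simp <;> omega
    have hcount := colorCount_blockColoring t ht
    have hset : ((Finset.univ.filter fun f : Fin (2 * k) → Fin 3 => ∀ c, colorCount f c ≤ k).filter
        fun f => (fun d => k - colorCount f (Fin.rev d)) = t) =
        Finset.univ.filter fun f => ∀ c, colorCount f c =
          colorCount (blockColoring k (t 0) (t 1)) c := by
      ext f
      simp only [Finset.mem_filter, Finset.mem_univ, true_and, _root_.funext_iff]
      constructor
      · rintro ⟨h1, h2⟩ c
        have h3 := h2 c.rev
        have h4 := hcount c.rev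
        rw [Fin.rev_rev] at h3 h4
        have := h1 c
        omega
      · intro h
        refine ⟨fun c => ?_, fun d => ?_⟩
        · have h4 := hcount c.rev
          rw [Fin.rev_rev] at h4
          rw [h c, h4]
          omega
        · rw [h, hcount]
          have := hle d
          omega
    have hterm : ∀ f ∈ Finset.univ.filter fun f : Fin (2 * k) → Fin 3 => ∀ c, colorCount f c =
          colorCount (blockColoring k (t 0) (t 1)) c,
        homEval (2 * r) (fun i => colorPoint (f i)) P •
          ∏ d : Fin 3, (X d : MvPolynomial (Fin 3) ℂ) ^ (k - colorCount f d.rev) =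
        spec r k P (t 0) (t 1) • (X 0 ^ t 0 * X 1 ^ t 1 * X 2 ^ t 2) := by
      intro f hf
      have hf := (Finset.mem_filter.mp hf).2
      obtain ⟨σ, rfl⟩ := exists_perm_of_colorCount_eq hf
      rw [spec_eq hdeg ht', ← homEval_comp_perm hsymm
        (fun i => colorPoint (blockColoring k (t 0) (t 1) i)) σ]
      congr 1
      rw [Fin.prod_univ_three]
      simp only [hf, hcount, Nat.sub_sub_self (hle _)]
    have hcard := card_colorCount_eq_mul_prod_factorial (blockColoring k (t 0) (t 1))
    have hprod : ∏ c, (colorCount (blockColoring k (t 0) (t 1)) c).factorial =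
        (k - t 0).factorial * (k - t 1).factorial * (k - t 2).factorial := by
      rw [← Equiv.prod_comp Fin.revPerm, Fin.prod_univ_three]
      simp only [Fin.revPerm_apply, hcount]
    rw [hprod] at hcard
    rw [hset, Finset.sum_congr rfl hterm, Finset.sum_const, ← Nat.cast_smul_eq_nsmul ℂ, smul_smul,
      ← smul_eq_C_mul, smul_smul]
    congr 1
    rw [← hcard]
    push_cast
    have h0 : ∀ m : ℕ, (m.factorial : ℂ) ≠ 0 := fun m => Nat.cast_ne_zero.mpr m.factorial_ne_zero
    field_simp [h0]
  · intro f hf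
    have hf := (Finset.mem_filter.mp hf).2
    rw [Finset.Nat.mem_antidiagonalTuple]
    have hs := sum_colorCount f
    rw [← Equiv.sum_comp Fin.revPerm, Fin.sum_univ_three] at hs
    simp only [Fin.revPerm_apply] at hs
    rw [Fin.sum_univ_three]
    have := fun d : Fin 3 => hf d.rev
    have h0 := this 0
    have h1 := this 1
    have h2 := this 2
    omega

theorem genFun_isHomogeneous (P : MvPolynomial (Fin (2 * k)) ℂ) :
    (genFun r k P).IsHomogeneous k := by
  refine IsHomogeneous.sum _ _ _ fun t ht => ?_
  rw [Finset.Nat.mem_antidiagonalTuple, Fin.sum_univ_three] at ht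
  have h := ((isHomogeneous_X_pow (R := ℂ) (0 : Fin 3) (t 0)).mul
    (isHomogeneous_X_pow 1 (t 1))).mul (isHomogeneous_X_pow 2 (t 2))
  rw [ht] at h
  simpa using (isHomogeneous_C _ _).mul h

theorem genFun_isSymmetric {P : MvPolynomial (Fin (2 * k)) ℂ} (hr : 1 ≤ r)
    (hP : P ∈ uniformStates (2 * k) (2 * r)) : (genFun r k P).IsSymmetric := by
  intro σ
  have hinv := isSemiInv_of_mem_uniformStates (w := r * (2 * k)) (by ring) hP
  have h := triPoly_eq_smul_genFun hr hP.1 hP.2.1 hinv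
  have h0 : ((2 * k).factorial : ℂ) ≠ 0 := Nat.cast_ne_zero.mpr (Nat.factorial_ne_zero _)
  have h1 : genFun r k P = ((2 * k).factorial : ℂ)⁻¹ • triPoly (2 * r) P := by
    rw [h, inv_smul_smul₀ h0]
  have h2 : ((Equiv.Perm.sign σ : ℤ) : ℂ) ^ (r * (2 * k)) = 1 := by
    rw [mul_left_comm, pow_mul, ← Int.cast_pow, ← Units.val_pow_eq_pow_val, Int.units_sq]
    simp
  rw [h1, map_smul, rename_triPoly hP.2.1 hinv, h2, one_smul]

/-- On the quantization of a uniform state, evaluation at a combination of the three points is the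
generating function of the specializations. -/
theorem triEval_inclCoeff_quantize {P : MvPolynomial (Fin (2 * k)) ℂ} (hr : 1 ≤ r)
    (hP : P ∈ uniformStates (2 * k) (2 * r)) :
    triEval (2 * r) (inclCoeff (2 * r) (quantize (2 * r) (2 * k) P)) = toFrac (genFun r k P) := by
  have hinv := isSemiInv_of_mem_uniformStates (w := r * (2 * k)) (by ring) hP
  have h0 : ((2 * k).factorial : ℂ) ≠ 0 := Nat.cast_ne_zero.mpr (Nat.factorial_ne_zero _)
  have h1 : (fun _ => ((2 * k : ℕ) : ℚ) / 2 - (2 * k / 2 : ℕ) : Fin 3 → ℚ) = 0 := by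
    ext d
    rw [Nat.mul_div_cancel_left k (by norm_num)]
    push_cast
    simp
  rw [inclCoeff_quantize hP.2.1, map_smul, triEval_umbral_eq_toFrac hr hP.2.1 hinv,
    triPoly_eq_smul_genFun hr hP.1 hP.2.1 hinv, h1, fracMonomial_zero, one_mul, map_smul,
    inv_smul_smul₀ h0]

/-- `triEval` maps even invariants to symmetric polynomials with non-negative integral exponents. -/
theorem triEval_mem (hr : 1 ≤ r) (I : evenInvariants (2 * r)) :
    (triEval (2 * r)).comp (inclCoeff (2 * r)) I ∈ (symmetricSubalgebra (Fin 3) ℂ).map toFrac := by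
  obtain ⟨I, hI⟩ := I
  change I ∈ ⨆ k : ℕ, invariants (2 * r) (2 * k) at hI
  refine Submodule.iSup_induction _ (motive := fun I => (triEval (2 * r)).comp
    (inclCoeff (2 * r)) I ∈ (symmetricSubalgebra (Fin 3) ℂ).map toFrac) hI (fun k I hI => ?_)
    (by rw [map_zero]; exact zero_mem _) fun I J hI hJ => by rw [map_add]; exact add_mem hI hJ
  obtain ⟨P, hP⟩ :=
    (quantizeEquiv (n := 2 * r) (N := 2 * k) (w := r * (2 * k)) (by ring)).surjective ⟨I, hI⟩
  have h := congrArg Subtype.val hP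
  rw [coe_quantizeEquiv] at h
  change _ = I at h
  rw [AlgHom.comp_apply, ← h, triEval_inclCoeff_quantize hr P.2]
  exact ⟨_, genFun_isSymmetric hr P.2, rfl⟩

/-- The tricoloring homomorphism `K`: the corestriction of `triEval` to symmetric polynomials. -/
def tricoloringHom (r : ℕ) (hr : 1 ≤ r) :
    evenInvariants (2 * r) →ₐ[ℂ] symmetricSubalgebra (Fin 3) ℂ :=
  (Subalgebra.equivMapOfInjective (symmetricSubalgebra (Fin 3) ℂ) toFrac
    toFrac_injective).symm.toAlgHom.comp
    ((((triEval (2 * r)).comp (inclCoeff (2 * r))).comp (evenInvariants (2 * r)).val).codRestrict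
      _ (triEval_mem hr))

theorem toFrac_tricoloringHom (hr : 1 ≤ r) (I : evenInvariants (2 * r)) :
    toFrac (tricoloringHom r hr I : MvPolynomial (Fin 3) ℂ) =
      triEval (2 * r) (inclCoeff (2 * r) I) := by
  rw [← Subalgebra.coe_equivMapOfInjective_apply _ toFrac toFrac_injective]
  simp [tricoloringHom]
  rfl

/-! ### Graph monomials -/

theorem WGraph.prod_mult_eq {G : WGraph m} (hG : G.IsRegular n) (y : Fin m → ℂ) :
    ∏ i, ∏ j, (y i * y j) ^ G.mult i j = ∏ i, y i ^ n := by
  simp only [mul_pow, Finset.prod_mul_distrib]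
  rw [Finset.prod_comm (f := fun i j => y j ^ G.mult i j)]
  simp only [Finset.prod_pow_eq_pow_sum]
  rw [← Finset.prod_mul_distrib]
  refine Finset.prod_congr rfl fun i _ => ?_
  rw [← pow_add, ← Finset.sum_add_distrib, ← hG i]
  simp only [add_comm]

theorem WGraph.two_mul_sum_mult {G : WGraph m} (hG : G.IsRegular n) :
    2 * ∑ i, ∑ j, G.mult i j = n * m := by
  have h : ∑ j, ∑ i, (G.mult i j + G.mult j i) = n * m := by
    rw [Finset.sum_congr rfl fun j _ => hG j]
    simp [mul_comm]
  simp only [Finset.sum_add_distrib] at h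
  rw [Finset.sum_comm] at h
  omega

theorem WGraph.degreeOf_monomial_le {G : WGraph m} (hG : G.IsRegular n) (i : Fin m) :
    (G.monomial ℂ).degreeOf i ≤ n := by
  have h1 : ∀ a b : Fin m, ((X a - X b : MvPolynomial (Fin m) ℂ) ^ G.mult a b).degreeOf i ≤
      (if i = a then G.mult a b else 0) + if i = b then G.mult a b else 0 := by
    intro a b
    refine (degreeOf_pow_le _ _ _).trans ?_
    have := degreeOf_sub_le i (X a : MvPolynomial (Fin m) ℂ) (X b)
    rw [degreeOf_X, degreeOf_X] at this
    refine (Nat.mul_le_mul_left _ this).trans ?_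
    split_ifs <;> simp
  refine (degreeOf_prod_le _ _ _).trans ((Finset.sum_le_sum fun a _ =>
    (degreeOf_prod_le _ _ _).trans (Finset.sum_le_sum fun b _ => h1 a b)).trans ?_)
  simp only [Finset.sum_add_distrib, Finset.sum_ite_eq, Finset.mem_univ, if_true]
  rw [Finset.sum_comm]
  simp only [Finset.sum_ite_eq, Finset.mem_univ, if_true]
  rw [← Finset.sum_add_distrib, ← hG i]
  simp only [add_comm, le_refl]

/-- The multihomogenization of a graph monomial is a product of `2 × 2` determinants. -/
theorem WGraph.homEval_monomial {G : WGraph m} (hG : G.IsRegular n) (u : Fin m → Fin 2 → ℂ) :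
    homEval n u (G.monomial ℂ) =
      ∏ i, ∏ j, (u i 0 * u j 1 - u j 0 * u i 1) ^ G.mult i j := by
  have key : ∀ u : Fin m → Fin 2 → ℂ, (∀ i, u i 1 ≠ 0) → homEval n u (G.monomial ℂ) =
      ∏ i, ∏ j, (u i 0 * u j 1 - u j 0 * u i 1) ^ G.mult i j := by
    intro u hu
    have e : u = fun i => u i 1 • ![u i 0 / u i 1, 1] := by
      ext i j
      fin_cases j <;> simp [mul_div_cancel₀ _ (hu i)]
    conv_lhs => rw [e]
    rw [homEval_smul (G.degreeOf_monomial_le hG), homEval_affine, ← G.prod_mult_eq hG,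
      WGraph.monomial]
    simp only [map_prod, map_pow, map_sub, eval_X, ← Finset.prod_mul_distrib, ← mul_pow]
    refine Finset.prod_congr rfl fun i _ => Finset.prod_congr rfl fun j _ => ?_
    congr 1
    have := hu i
    have := hu j
    field_simp
  -- the case in which some of the points are at infinity follows by continuity
  have hcont : Continuous fun (t : ℂ) (i : Fin m) => ![u i 0, u i 1 + t] := by
    refine continuous_pi fun i => continuous_pi fun j => ?_
    fin_cases j <;> simp <;> fun_prop
  have h1 : Filter.Tendsto
      (fun t : ℂ => homEval n (fun i => ![u i 0, u i 1 + t]) (G.monomial ℂ))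
      (nhdsWithin 0 {0}ᶜ) (nhds (homEval n (fun i => ![u i 0, u i 1 + 0]) (G.monomial ℂ))) :=
    (((continuous_homEval _).comp hcont).tendsto 0).mono_left nhdsWithin_le_nhds
  have hcont2 : Continuous fun t : ℂ =>
      ∏ i, ∏ j, (u i 0 * (u j 1 + t) - u j 0 * (u i 1 + t)) ^ G.mult i j := by fun_prop
  have h2 := (hcont2.tendsto 0).mono_left (nhdsWithin_le_nhds (s := {0}ᶜ))
  have e : (fun i => ![u i 0, u i 1 + 0]) = u := by
    ext i j
    fin_cases j <;> simp
  rw [e] at h1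
  simp only [add_zero] at h2
  refine tendsto_nhds_unique (h1.congr' ?_) h2
  have hne : ∀ᶠ t : ℂ in nhdsWithin 0 {0}ᶜ, ∀ i, u i 1 + t ≠ 0 := by
    refine Filter.eventually_all.mpr fun i => ?_
    by_cases hi : u i 1 = 0
    · filter_upwards [self_mem_nhdsWithin] with t ht
      simpa [hi] using ht
    · have : Filter.Tendsto (fun t : ℂ => u i 1 + t) (nhdsWithin 0 {0}ᶜ) (nhds (u i 1 + 0)) :=
        ((continuous_const.add continuous_id).tendsto 0).mono_left nhdsWithin_le_nhds
      rw [add_zero] at this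
      exact this.eventually_ne hi
  filter_upwards [hne] with t ht
  rw [key _ (by simpa using ht)]
  simp

theorem WGraph.isSemiInv_monomial {G : WGraph m} (hG : G.IsRegular (2 * r)) :
    IsSemiInv (2 * r) (r * m) (G.monomial ℂ) := by
  intro M _ u
  have hw : r * m = ∑ i, ∑ j, G.mult i j := by
    have := G.two_mul_sum_mult hG
    lia
  rw [G.homEval_monomial hG, G.homEval_monomial hG, hw]
  simp only [← Finset.prod_pow_eq_pow_sum, ← Finset.prod_mul_distrib, ← mul_pow]
  refine Finset.prod_congr rfl fun i _ => Finset.prod_congr rfl fun j _ => ?_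
  congr 1
  simp only [Matrix.mulVec, dotProduct, Fin.sum_univ_two, Matrix.det_fin_two]
  ring

theorem WGraph.homEval_colorPoint {G : WGraph m} (hG : G.IsRegular n) (η : Fin m → Fin 3) :
    homEval n (fun i => colorPoint (η i)) (G.monomial ℂ) = G.colorSign η := by
  rw [G.homEval_monomial hG, WGraph.colorSign]
  push_cast
  refine Finset.prod_congr rfl fun i _ => Finset.prod_congr rfl fun j _ => ?_
  congr 1
  generalize η i = c
  generalize η j = d
  have h2 : Int.sign 2 = 1 := rfl
  fin_cases c <;> fin_cases d <;> simp [colorPoint, h2]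

theorem WGraph.colorSign_ne_zero_iff {G : WGraph m} {η : Fin m → Fin 3} :
    G.colorSign η ≠ 0 ↔ G.IsProper η := by
  rw [WGraph.colorSign, Finset.prod_ne_zero_iff]
  refine forall_congr' fun i => ?_
  simp only [Finset.mem_univ, true_imp_iff, Finset.prod_ne_zero_iff]
  refine forall_congr' fun j => ?_
  rw [Ne, pow_eq_zero_iff', Int.sign_eq_zero_iff_zero, sub_eq_zero, Nat.cast_inj, Fin.val_inj]
  tauto

theorem WGraph.triEval_ups {G : WGraph m} (hG : G.IsRegular n) :
    triEval n G.ups = G.tricolorSum := by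
  classical
  rw [WGraph.ups, map_smul, triEval_umbral, WGraph.tricolorSum]
  congr 1
  rw [Finset.sum_filter]
  refine Finset.sum_congr rfl fun η _ => ?_
  rw [G.homEval_colorPoint hG]
  split_ifs with h
  · congr 2
    ext d
    fin_cases d <;> rfl
  · rw [← G.colorSign_ne_zero_iff, not_not] at h
    simp [h]

/-- At a proper coloring the multihomogenization of the graph monomial does not vanish, so that no
color occurs on more than half of the nodes. -/
theorem WGraph.two_mul_colorCount_le {G : WGraph m} (hr : 1 ≤ r) (hG : G.IsRegular (2 * r))
    {η : Fin m → Fin 3} (hη : G.IsProper η) (c : Fin 3) : 2 * colorCount η c ≤ m := by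
  by_contra! h
  have h0 := homEval_colorPoint_eq_zero hr (G.degreeOf_monomial_le hG) (G.isSemiInv_monomial hG) h
  rw [G.homEval_colorPoint hG, Int.cast_eq_zero] at h0
  exact G.colorSign_ne_zero_iff.mpr hη h0

theorem WGraph.exists_tricolorSum_eq_of_odd {G : WGraph m} (hr : 1 ≤ r) (hm : Odd m)
    (hG : G.IsRegular (2 * r)) :
    ∃ q : MvPolynomial (Fin 3) ℂ,
      G.tricolorSum = fracMonomial (fun _ => 1 / 2) * toFrac q ∧
      ∀ σ : Equiv.Perm (Fin 3), rename σ q = (((Equiv.Perm.sign σ : ℤ) : ℂ) ^ r) • q := by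
  refine ⟨(G.u : ℂ)⁻¹ • triPoly (2 * r) (G.monomial ℂ), ?_, fun σ => ?_⟩
  · have e : (fun _ => (m : ℚ) / 2 - (m / 2 : ℕ) : Fin 3 → ℚ) = fun _ => 1 / 2 := by
      obtain ⟨h, rfl⟩ := hm
      ext d
      rw [show (2 * h + 1) / 2 = h by omega]
      push_cast
      ring
    rw [← G.triEval_ups hG, WGraph.ups, map_smul, map_smul, mul_smul_comm,
      triEval_umbral_eq_toFrac hr (G.degreeOf_monomial_le hG) (G.isSemiInv_monomial hG), e]
  · have e : ((Equiv.Perm.sign σ : ℤ) : ℂ) ^ m = ((Equiv.Perm.sign σ : ℤ) : ℂ) := by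
      rcases Int.units_eq_one_or (Equiv.Perm.sign σ) with h | h <;> simp [h, hm.neg_one_pow]
    rw [map_smul, rename_triPoly (G.degreeOf_monomial_le hG) (G.isSemiInv_monomial hG),
      smul_comm, mul_comm, pow_mul, e]

theorem WGraph.psi_mem_uniformStates {G : WGraph m} (hG : G.IsRegular (2 * r)) :
    G.psi ∈ uniformStates m (2 * r) := by
  refine Submodule.smul_mem _ _ (mem_uniformStates_of_isSemiInv (w := r * m) (by ring)
    (symmetrize_isSymmetric _) (degreeOf_symmetrize_le (G.degreeOf_monomial_le hG)) ?_)
  intro M hM u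
  rw [symmetrize, map_sum, map_sum, Finset.mul_sum]
  refine Finset.sum_congr rfl fun σ _ => ?_
  rw [homEval_rename, homEval_rename, ← G.isSemiInv_monomial hG M hM]
  rfl

theorem WGraph.inclCoeff_quantize_psi {G : WGraph m} (hG : G.IsRegular n) :
    inclCoeff n (quantize n m G.psi) = G.ups := by
  have h0 : (m.factorial : ℂ) ≠ 0 := Nat.cast_ne_zero.mpr m.factorial_ne_zero
  rw [WGraph.psi, map_smul, map_smul, quantize_symmetrize, map_smul,
    inclCoeff_quantize (G.degreeOf_monomial_le hG), smul_inv_smul₀ h0, WGraph.ups]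

/-! ### Disjoint unions and Gauss's lemma -/

/-- The content of an integer polynomial. -/
def intContent {τ : Type} (f : MvPolynomial τ ℤ) : ℕ := f.support.gcd fun ν => (f.coeff ν).natAbs

theorem dvd_intContent_iff {τ : Type} {f : MvPolynomial τ ℤ} {d : ℕ} :
    d ∣ intContent f ↔ C (d : ℤ) ∣ f := by
  rw [intContent, Finset.dvd_gcd_iff, C_dvd_iff_dvd_coeff]
  refine ⟨fun h ν => ?_, fun h ν _ => Int.natCast_dvd.mp (h ν)⟩
  by_cases hν : ν ∈ f.support
  · exact Int.natCast_dvd.mpr (h ν hν)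
  · rw [notMem_support_iff.mp hν]
    exact dvd_zero _

theorem intContent_C_mul {τ : Type} (a : ℕ) (f : MvPolynomial τ ℤ) :
    intContent (C (a : ℤ) * f) = a * intContent f := by
  rcases Nat.eq_zero_or_pos a with rfl | ha
  · simp [intContent]
  · have hs : (C (a : ℤ) * f).support = f.support := by
      ext ν
      rw [mem_support_iff, mem_support_iff, coeff_C_mul]
      simp [ha.ne']
    rw [intContent, intContent, hs]
    simp only [coeff_C_mul, Int.natAbs_mul, Int.natAbs_natCast]
    rw [Finset.gcd_mul_left, normalize_eq]

theorem exists_eq_C_mul_primitive {τ : Type} {f : MvPolynomial τ ℤ} (hf : f ≠ 0) :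
    ∃ g, f = C (intContent f : ℤ) * g ∧ intContent g = 1 := by
  obtain ⟨g, hg⟩ := dvd_intContent_iff.mp (dvd_refl (intContent f))
  refine ⟨g, hg, ?_⟩
  have h := congrArg intContent hg
  rw [intContent_C_mul] at h
  have h0 : intContent f ≠ 0 := by
    intro h0
    rw [h0] at hg
    exact hf (by simpa using hg)
  exact Nat.eq_of_mul_eq_mul_left (Nat.pos_of_ne_zero h0) (by rw [← h, mul_one])

/-- Gauss's lemma in several variables. -/
theorem intContent_mul {τ : Type} (f g : MvPolynomial τ ℤ) :
    intContent (f * g) = intContent f * intContent g := by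
  by_cases hf : f = 0
  · simp [hf, intContent]
  by_cases hg : g = 0
  · simp [hg, intContent]
  obtain ⟨f', hf', hf1⟩ := exists_eq_C_mul_primitive hf
  obtain ⟨g', hg', hg1⟩ := exists_eq_C_mul_primitive hg
  have h1 : intContent (f' * g') = 1 := by
    by_contra h
    obtain ⟨p, hp, hpd⟩ := Nat.exists_prime_and_dvd h
    have hC : Prime (C (p : ℤ) : MvPolynomial τ ℤ) :=
      (prime_C_iff τ).mpr (Nat.prime_iff_prime_int.mp hp)
    rcases hC.dvd_or_dvd (dvd_intContent_iff.mp hpd) with h | h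
    · exact hp.one_lt.ne' (Nat.dvd_one.mp (hf1 ▸ dvd_intContent_iff.mpr h))
    · exact hp.one_lt.ne' (Nat.dvd_one.mp (hg1 ▸ dvd_intContent_iff.mpr h))
  have h2 : f * g = C ((intContent f * intContent g : ℕ) : ℤ) * (f' * g') := by
    conv_lhs => rw [hf', hg']
    push_cast
    rw [C_mul]
    ring
  rw [h2, intContent_C_mul, h1, mul_one]

/-- Umbral evaluation is multiplicative on products of polynomials in disjoint sets of variables. -/
theorem umbral_rename_mul_rename (R : Type) [CommRing R] (P : MvPolynomial (Fin m₁) R)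
    (P' : MvPolynomial (Fin m₂) R) :
    umbral R (m₁ + m₂) (rename (Fin.castAdd m₂) P * rename (Fin.natAdd m₁) P') =
      umbral R m₁ P * umbral R m₂ P' := by
  induction P using MvPolynomial.induction_on' with
  | monomial p c =>
    induction P' using MvPolynomial.induction_on' with
    | monomial p' c' =>
      have h1 : ∀ i, Finsupp.mapDomain (Fin.natAdd m₁) p' (Fin.castAdd m₂ i) = 0 := fun i =>
        Finsupp.mapDomain_of_notMem_range _ _ <| by
          rintro ⟨j, hj⟩
          have := congrArg Fin.val hj
          simp at this
          omega
      have h2 : ∀ i, Finsupp.mapDomain (Fin.castAdd m₂) p (Fin.natAdd m₁ i) = 0 := fun i =>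
        Finsupp.mapDomain_of_notMem_range _ _ <| by
          rintro ⟨j, hj⟩
          have := congrArg Fin.val hj
          simp at this
          omega
      rw [rename_monomial, rename_monomial, monomial_mul, umbral_monomial, umbral_monomial,
        umbral_monomial, Fin.prod_univ_add]
      simp only [Finsupp.add_apply, h1, h2, add_zero, zero_add,
        Finsupp.mapDomain_apply (Fin.castAdd_injective m₁ m₂),
        Finsupp.mapDomain_apply (Fin.natAdd_injective m₂ m₁)]
      rw [smul_mul_smul_comm]
    | add Q Q' h h' => simp only [map_add, mul_add, h, h']
  | add Q Q' h h' => simp only [map_add, add_mul, h, h']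

namespace WGraph

theorem disjUnion_isRegular {G₁ : WGraph m₁} {G₂ : WGraph m₂} (h₁ : G₁.IsRegular n)
    (h₂ : G₂.IsRegular n) : (G₁.disjUnion G₂).IsRegular n := by
  intro j
  refine Fin.addCases (fun j => ?_) (fun j => ?_) j
  · simpa [Fin.sum_univ_add, disjUnion] using h₁ j
  · simpa [Fin.sum_univ_add, disjUnion] using h₂ j

theorem monomial_disjUnion (R : Type) [CommRing R] (G₁ : WGraph m₁) (G₂ : WGraph m₂) :
    (G₁.disjUnion G₂).monomial R = rename (Fin.castAdd m₂) (G₁.monomial R) *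
      rename (Fin.natAdd m₁) (G₂.monomial R) := by
  simp [monomial, Fin.prod_univ_add, disjUnion, map_prod]

theorem u_disjUnion (G₁ : WGraph m₁) (G₂ : WGraph m₂) :
    (G₁.disjUnion G₂).u = G₁.u * G₂.u := by
  change intContent _ = intContent _ * intContent _
  rw [monomial_disjUnion, umbral_rename_mul_rename, intContent_mul]

theorem ups_disjUnion (G₁ : WGraph m₁) (G₂ : WGraph m₂) :
    (G₁.disjUnion G₂).ups = G₁.ups * G₂.ups := by
  rw [ups, u_disjUnion, monomial_disjUnion, umbral_rename_mul_rename, ups, ups,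
    smul_mul_smul_comm, Nat.cast_mul, mul_inv]

theorem tricolorSum_disjUnion {G₁ : WGraph m₁} {G₂ : WGraph m₂} (h₁ : G₁.IsRegular n)
    (h₂ : G₂.IsRegular n) :
    (G₁.disjUnion G₂).tricolorSum = G₁.tricolorSum * G₂.tricolorSum := by
  rw [← triEval_ups (disjUnion_isRegular h₁ h₂), ups_disjUnion, map_mul, triEval_ups h₁,
    triEval_ups h₂]

end WGraph

end

end Tricoloring

theorem mainTheorem7 (r : ℕ) (hr : 1 ≤ r) :
    -- the limits that define the three-point specializations exist
    (∀ (k : ℕ), ∀ P ∈ Tricoloring.uniformStates (2 * k) (2 * r), ∀ a b c : ℕ, a + b + c = k →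
      Filter.Tendsto (Tricoloring.specFun r k P a b) (Bornology.cobounded ℂ)
        (nhds (Tricoloring.spec r k P a b))) ∧
    -- the quantization isomorphism
    ∃ Q : ∀ k : ℕ, Tricoloring.uniformStates (2 * k) (2 * r) ≃ₗ[ℂ]
        Tricoloring.invariants (2 * r) (2 * k),
      (∀ (k : ℕ) (P : Tricoloring.uniformStates (2 * k) (2 * r)),
        Tricoloring.inclCoeff (2 * r) (Q k P : MvPolynomial (Fin (2 * r + 1)) ℂ) =
          ((2 * k).factorial : ℂ)⁻¹ •
            Tricoloring.umbral ℂ (2 * k) (P : MvPolynomial (Fin (2 * k)) ℂ)) ∧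
    -- the tricoloring homomorphism
    ∃ K : Tricoloring.evenInvariants (2 * r) →ₐ[ℂ] MvPolynomial.symmetricSubalgebra (Fin 3) ℂ,
      (∀ (k : ℕ) (P : Tricoloring.uniformStates (2 * k) (2 * r)),
        (K (Tricoloring.ofPiece (Q k P)) : MvPolynomial (Fin 3) ℂ) =
          Tricoloring.genFun r k (P : MvPolynomial (Fin (2 * k)) ℂ)) ∧
      -- it preserves degrees
      (∀ (k : ℕ) (I : Tricoloring.invariants (2 * r) (2 * k)),
        (K (Tricoloring.ofPiece I) : MvPolynomial (Fin 3) ℂ).IsHomogeneous k) ∧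
      -- on a graph with an even number of nodes it is the signed sum over proper tricolorings
      (∀ (k : ℕ) (G : Tricoloring.WGraph (2 * k)), G.IsRegular (2 * r) →
        ∃ hG : G.psi ∈ Tricoloring.uniformStates (2 * k) (2 * r),
          Tricoloring.inclCoeff (2 * r)
            (Q k ⟨G.psi, hG⟩ : MvPolynomial (Fin (2 * r + 1)) ℂ) = G.ups ∧
          Tricoloring.toFrac
            (K (Tricoloring.ofPiece (Q k ⟨G.psi, hG⟩)) : MvPolynomial (Fin 3) ℂ) =
              G.tricolorSum) ∧
      -- all exponents in the signed sum are non-negative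
      (∀ (m : ℕ) (G : Tricoloring.WGraph m), G.IsRegular (2 * r) →
        ∀ η : Fin m → Fin 3, G.IsProper η → ∀ c, 2 * Tricoloring.colorCount η c ≤ m) ∧
      -- an odd number of nodes
      (∀ (m : ℕ) (G : Tricoloring.WGraph m), Odd m → G.IsRegular (2 * r) →
        ∃ q : MvPolynomial (Fin 3) ℂ,
          G.tricolorSum = Tricoloring.fracMonomial (fun _ => 1 / 2) * Tricoloring.toFrac q ∧
          ∀ σ : Equiv.Perm (Fin 3),
            MvPolynomial.rename σ q = (((Equiv.Perm.sign σ : ℤ) : ℂ) ^ r) • q) ∧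
      -- disjoint unions
      (∀ (m₁ m₂ : ℕ) (G₁ : Tricoloring.WGraph m₁) (G₂ : Tricoloring.WGraph m₂),
        G₁.IsRegular (2 * r) → G₂.IsRegular (2 * r) →
          (G₁.disjUnion G₂).IsRegular (2 * r) ∧
          (G₁.disjUnion G₂).ups = G₁.ups * G₂.ups ∧
          (G₁.disjUnion G₂).tricolorSum = G₁.tricolorSum * G₂.tricolorSum) := by
  have hw : ∀ k : ℕ, 2 * (r * (2 * k)) = 2 * r * (2 * k) := fun k => by ring
  have hK : ∀ (k : ℕ) (P : Tricoloring.uniformStates (2 * k) (2 * r)),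
      (Tricoloring.tricoloringHom r hr (Tricoloring.ofPiece
        (Tricoloring.quantizeEquiv (hw k) P)) : MvPolynomial (Fin 3) ℂ) =
          Tricoloring.genFun r k (P : MvPolynomial (Fin (2 * k)) ℂ) := fun k P =>
    Tricoloring.toFrac_injective <| (Tricoloring.toFrac_tricoloringHom hr _).trans
      (Tricoloring.triEval_inclCoeff_quantize hr P.2)
  refine ⟨fun k P hP a b c habc => ?_, fun k => Tricoloring.quantizeEquiv (hw k),
    fun k P => Tricoloring.inclCoeff_quantize P.2.2.1, Tricoloring.tricoloringHom r hr, hK,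
    fun k I => ?_, fun k G hG => ⟨G.psi_mem_uniformStates hG, G.inclCoeff_quantize_psi hG, ?_⟩,
    fun m G hG η hη c => G.two_mul_colorCount_le hr hG hη c,
    fun m G hm hG => G.exists_tricolorSum_eq_of_odd hr hm hG,
    fun m₁ m₂ G₁ G₂ h₁ h₂ => ⟨Tricoloring.WGraph.disjUnion_isRegular h₁ h₂,
      G₁.ups_disjUnion G₂, Tricoloring.WGraph.tricolorSum_disjUnion h₁ h₂⟩⟩
  · rw [Tricoloring.spec_eq hP.2.1 habc]
    exact Tricoloring.tendsto_specFun hP.2.1 habc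
  · obtain ⟨P, rfl⟩ := (Tricoloring.quantizeEquiv (hw k)).surjective I
    rw [hK]
    exact Tricoloring.genFun_isHomogeneous _
  · rw [Tricoloring.toFrac_tricoloringHom, ← G.triEval_ups hG, ← G.inclCoeff_quantize_psi hG]
    rfl
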